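/- Let $\mathcal H$ be a complex separable Hilbert space (of any dimension, in particular infinite), let $I\subseteq\mathbb R$ be an open interval, and let $\theta\mapsto\rho_\theta$, $\theta\in I$, be a family of states (positive trace class operators with $\operatorname{Tr}\rho_\theta=1$) such that $\ker\rho_\theta=\{0\}$ for all $\theta\in I$ and $\theta\mapsto\rho_\theta$ is real analytic as a map from $I$ into the trace class $\mathcal B_1(\mathcal H)$. Fix $\theta\in I$, write $\rho=\rho_\theta$, let $\rho'$ be the derivative of the family at $\theta$, put $c=\|\rho'\|+1$, and let $D=D(\rho^{-1/2})=\operatorname{Ran}\rho^{1/2}$. For a bounded operator $A$ and $u,v\in D$ consider the sesquilinear forms (i) $h_A[u,v]=\int_0^\infty\langle(\rho+x)^{-1}u,\;A(\rho+x)^{-1}v\rangle\,dx$, (ii) $\hat h_A[u,v]=\langle\rho^{-1/2}u,\;A\,\rho^{-1/2}v\rangle$, (iii) $\tilde{\tilde h}_A[u,v]=\int_0^\infty\langle e^{-s\rho/2}u,\;A\,e^{-s\rho/2}v\rangle\,ds$. With $A=\rho'$ these are the forms of the Boltzmann–von Neumann logarithmic derivative $H$, of $\hat H=\rho^{-1/2}\rho'\rho^{-1/2}$,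 and of the symmetric logarithmic derivative $\tilde{\tilde H}$ (SLD), respectively. (As operators these are in general unbounded; they are understood through their forms with form domain $D$.) Let $X$ be any one of the three, and write $q_A$ for the corresponding form. **Theorem.** The integrals defining $q_{\rho'}$ and $q_{\rho'+c}$ converge absolutely on $D$, and the operator associated with the form $q_{\rho'+c}$, that is, the operator $K$ whose graph is the set of the pairs $(v,w)$ with $v\in D$ and $q_{\rho'+c}[u,v]=\langle u,w\rangle$ for all $u\in D$, is self-adjoint. The operator $\rho^{1/2}X\rho^{1/2}$ is bounded: there is a bounded operator $T$ on $\mathcal H$ such that $$\langle f,Tg\rangle=q_{\rho'}[\rho^{1/2}f,\rho^{1/2}g]\qquad\text{for all }f,g\in\mathcal H .$$ Moreover $\rho^{1/2}w=Tf$ whenever $f,w\in\mathcal H$ are such that $q_{\rho'}[u,\rho^{1/2}f]=\langle u,w\rangle$ for all $u\in D$ (that is, whenever $X\rho^{1/2}f=w$ is defined as a vector), the set $\{f:\rho^{1/2}f\in D(K)\}$ is dense in $\mathcal H$, and $\rho^{1/2}K\rho^{1/2}f=Tf+cf$ for all $f$ in it. The operator $T=\rho^{1/2}X\rho^{1/2}$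 is trace class, and its trace vanishes: $$\operatorname{Tr}\big(\rho^{1/2}X\rho^{1/2}\big)=0\qquad\text{for } X=\hat H,\;H,\;\tilde{\tilde H}.$$ Thus the expectation of $X$ in the state $\rho$, redefined as $\operatorname{Tr}(\rho^{1/2}X\rho^{1/2})$, exists and equals $0$. -/

import Mathlib

open scoped InnerProductSpace

namespace QuantumLD

noncomputable section

variable {E : Type*} [NormedAddCommGroup E] [InnerProductSpace ℂ E] [CompleteSpace E]

/-- The trace norm `‖T‖₁ = Tr |T|`, where `|T| = (T* T)^{1/2}` and the trace of the positive operator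
`|T|` is the sum of its diagonal elements along an orthonormal basis. That sum is the same for every
orthonormal basis, so the supremum over all orthonormal bases is this common value. -/
def traceNorm (T : E →L[ℂ] E) : ENNReal :=
  ⨆ (w : Set E) (b : HilbertBasis w ℂ E), ∑' i, ENNReal.ofReal (RCLike.re ⟪b i, CFC.abs T (b i)⟫_ℂ)

/-- Membership in the trace class `𝓑₁(E)`. -/
def IsTraceClass (T : E →L[ℂ] E) : Prop := traceNorm T ≠ ⊤

/-- `Tr T = z`: along every orthonormal basis the diagonal series of `T` converges (unconditionally)
to `z`. -/
def HasTrace (T : E →L[ℂ] E) (z : ℂ) : Prop :=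
  ∀ (w : Set E) (b : HilbertBasis w ℂ E), HasSum (fun i => ⟪b i, T (b i)⟫_ℂ) z

/-- Quantum states: positive trace class operators of trace one. -/
structure IsState (ρ : E →L[ℂ] E) : Prop where
  pos : ρ.IsPositive
  traceClass : IsTraceClass ρ
  trace_one : HasTrace ρ 1

/-- Real analyticity on `I` of a map into the Banach space `𝓑₁(E)`: around each point of `I` it is
the sum, in trace norm, of a power series with coefficients in `𝓑₁(E)`. -/
def IsTraceNormAnalyticOn (ρ : ℝ → E →L[ℂ] E) (I : Set ℝ) : Prop :=
  ∀ θ₀ ∈ I, ∃ r : ℝ, 0 < r ∧ ∃ a : ℕ → E →L[ℂ] E, (∀ n, IsTraceClass (a n)) ∧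
    ∀ θ ∈ I, |θ - θ₀| < r →
      Filter.Tendsto
        (fun N : ℕ => traceNorm (ρ θ - ∑ n ∈ Finset.range N, (((θ - θ₀ : ℝ) : ℂ) ^ n) • a n))
        Filter.atTop (nhds 0)

/-- The unbounded operator `ρ^{-1/2}`, the inverse of `ρ^{1/2}`; its domain `D(ρ^{-1/2})` is the range
of `ρ^{1/2}`. -/
def invSqrt (ρ : E →L[ℂ] E) : E →ₗ.[ℂ] E :=
  (((CFC.sqrt ρ : E →L[ℂ] E) : E →ₗ[ℂ] E).toPMap ⊤).inverse

theorem sqrt_mem_domain (ρ : E →L[ℂ] E) (f : E) : CFC.sqrt ρ f ∈ (invSqrt ρ).domain := by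
  rw [invSqrt, LinearPMap.inverse_domain]
  exact ⟨⟨f, trivial⟩, rfl⟩

/-- `ρ^{1/2} f` as an element of `D(ρ^{-1/2})`. -/
def sqrtVec (ρ : E →L[ℂ] E) (f : E) : (invSqrt ρ).domain := ⟨CFC.sqrt ρ f, sqrt_mem_domain ρ f⟩

/-- The resolvent `(ρ + x)⁻¹`. -/
def resolvent (ρ : E →L[ℂ] E) (x : ℝ) : E →L[ℂ] E := Ring.inverse (ρ + (x : ℂ) • 1)

/-- The contraction `e^{-sρ/2}`. -/
def semigroup (ρ : E →L[ℂ] E) (s : ℝ) : E →L[ℂ] E := NormedSpace.exp ((((-s / 2 : ℝ)) : ℂ) • ρ)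

/-- The three models of a logarithmic derivative whose form domain is `D(ρ^{-1/2})`: the
Boltzmann-von Neumann one, `ρ^{-1/2} ρ' ρ^{-1/2}`, and the symmetric one. -/
inductive Model where
  | boltzmannVonNeumann
  | sandwich
  | symmetric

/-- The sesquilinear form on `D(ρ^{-1/2})` of each model, with a bounded operator `A` in the place of
`ρ'`:
* `∫₀^∞ ⟨(ρ + x)⁻¹ u, A (ρ + x)⁻¹ v⟩ dx`,
* `⟨ρ^{-1/2} u, A ρ^{-1/2} v⟩`,
* `∫₀^∞ ⟨e^{-sρ/2} u, A e^{-sρ/2} v⟩ ds`. -/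
def ldForm (m : Model) (ρ A : E →L[ℂ] E) (u v : (invSqrt ρ).domain) : ℂ :=
  match m with
  | .boltzmannVonNeumann =>
      ∫ x in Set.Ioi (0 : ℝ), ⟪resolvent ρ x (u : E), A (resolvent ρ x (v : E))⟫_ℂ
  | .sandwich => ⟪invSqrt ρ u, A (invSqrt ρ v)⟫_ℂ
  | .symmetric =>
      ∫ s in Set.Ioi (0 : ℝ), ⟪semigroup ρ s (u : E), A (semigroup ρ s (v : E))⟫_ℂ

/-- Absolute convergence of the integral that defines the form. -/
def LDFormConverges (m : Model) (ρ A : E →L[ℂ] E) (u v : (invSqrt ρ).domain) : Prop :=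
  match m with
  | .boltzmannVonNeumann =>
      MeasureTheory.IntegrableOn
        (fun x : ℝ => ⟪resolvent ρ x (u : E), A (resolvent ρ x (v : E))⟫_ℂ) (Set.Ioi 0)
  | .sandwich => True
  | .symmetric =>
      MeasureTheory.IntegrableOn
        (fun s : ℝ => ⟪semigroup ρ s (u : E), A (semigroup ρ s (v : E))⟫_ℂ) (Set.Ioi 0)

/-- `(v, w)` lies in the graph of the operator associated with the form `q` with form domain `D`:
`v ∈ D`, and `q[u, v] = ⟨u, w⟩` for all `u ∈ D`. -/
def InFormGraph (D : Submodule ℂ E) (q : D → D → ℂ) (v w : E) : Prop :=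
  ∃ hv : v ∈ D, ∀ u : D, q u ⟨v, hv⟩ = ⟪(u : E), w⟫_ℂ

/-- `A + ‖A‖ + 1`, which is at least the identity if `A` is self-adjoint. -/
def shifted (A : E →L[ℂ] E) : E →L[ℂ] E := A + (((‖A‖ + 1 : ℝ)) : ℂ) • 1

end

end QuantumLD

open scoped InnerProductSpace

namespace QuantumLD

set_option linter.unusedSectionVars false

/-! ### Trace norm from diagonal sums -/

section TraceNorm

open Filter Topology

variable {E : Type*} [NormedAddCommGroup E] [InnerProductSpace ℂ E] [CompleteSpace E]

/-! Substitute `u = ρ^{1/2} f`, `v = ρ^{1/2} g`. Each of the three forms becomes `⟨f, Φ(A) g⟩` with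
`Φ(A) = ∫ B(x) A B(x) dμ(x)`, where the self-adjoint operators `B(x)` are `(ρ + x)⁻¹ ρ^{1/2}`, `1`
(with `μ` a point mass) or `e^{-sρ/2} ρ^{1/2}`, and `∫ B(x)² dμ = 1` (`exists_isSandwichFamily`).
Hence `f ↦ (x ↦ B(x) f)` is an isometry into `L²(μ; E)`, which makes `Φ(A)` bounded and `Φ` unital
and positive.

By Tonelli and `‖M*‖₂ = ‖M‖₂` for Hilbert-Schmidt norms, `Φ` preserves the trace of positive
operators (`diagNorm_average`). Splitting a self-adjoint `A` into positive and negative parts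
extends this to the trace class. Analyticity in trace norm makes `ρ'` trace class, and
differentiating `Tr ρ = 1` gives `Tr ρ' = 0` (`exists_hasDerivAt_trace_zero`), so `T = Φ(ρ')` has
trace zero.

For self-adjointness, `G = Φ(ρ' + c) = T + c` is bounded below by `1`. The operator of the shifted
form is `ρ^{-1/2} G ρ^{-1/2}`, the inverse of the bounded injective self-adjoint operator `ρ^{1/2}
G⁻¹ ρ^{1/2}`. -/

theorem inner_apply_eq_norm_sqrt_sq {P : E →L[ℂ] E} (hP : 0 ≤ P) (f : E) :
    ⟪f, P f⟫_ℂ = ((‖CFC.sqrt P f‖ ^ 2 : ℝ) : ℂ) := by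
  have hS : IsSelfAdjoint (CFC.sqrt P) := (CFC.sqrt_nonneg P).isSelfAdjoint
  conv_lhs => rw [← CFC.sqrt_mul_sqrt_self P hP]
  rw [mul_apply_eq_comp, ← hS.isSymmetric.apply_clm, inner_self_eq_norm_sq_to_K]
  push_cast
  rfl

theorem re_inner_apply_nonneg {P : E →L[ℂ] E} (hP : 0 ≤ P) (f : E) :
    0 ≤ RCLike.re ⟪f, P f⟫_ℂ := by
  rw [inner_apply_eq_norm_sqrt_sq hP, RCLike.re_eq_complex_re, Complex.ofReal_re]
  positivity

theorem enorm_inner_apply {P : E →L[ℂ] E} (hP : 0 ≤ P) (f : E) :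
    ‖⟪f, P f⟫_ℂ‖ₑ = ‖CFC.sqrt P f‖ₑ ^ 2 := by
  rw [inner_apply_eq_norm_sqrt_sq hP]
  rw [← ofReal_norm, ← ofReal_norm, ← ENNReal.ofReal_pow (norm_nonneg _)]
  simp

theorem ofReal_re_inner_apply {P : E →L[ℂ] E} (hP : 0 ≤ P) (f : E) :
    ENNReal.ofReal (RCLike.re ⟪f, P f⟫_ℂ) = ‖⟪f, P f⟫_ℂ‖ₑ := by
  rw [inner_apply_eq_norm_sqrt_sq hP, ← ofReal_norm, RCLike.re_eq_complex_re, Complex.ofReal_re,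
    Complex.norm_real, Real.norm_of_nonneg (by positivity)]

theorem enorm_sq_eq_tsum_inner {ι : Type*} (b : HilbertBasis ι ℂ E) (f : E) :
    ‖f‖ₑ ^ 2 = ∑' i, ‖⟪b i, f⟫_ℂ‖ₑ ^ 2 := by
  have h := (b.hasSum_inner_mul_inner f f).mapL Complex.reCLM
  have h2 : ∀ i, Complex.reCLM (⟪f, b i⟫_ℂ * ⟪b i, f⟫_ℂ) = ‖⟪b i, f⟫_ℂ‖ ^ 2 := by
    intro i
    rw [← inner_conj_symm, ← Complex.normSq_eq_conj_mul_self, Complex.normSq_eq_norm_sq]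
    exact Complex.ofReal_re _
  simp only [h2] at h
  rw [inner_self_eq_norm_sq_to_K] at h
  have h3 := h.tsum_eq
  have h4 : Complex.reCLM (((‖f‖ : ℝ) : ℂ) ^ 2) = ‖f‖ ^ 2 := by
    rw [← Complex.ofReal_pow]; exact Complex.ofReal_re _
  rw [← ofReal_norm, ← ENNReal.ofReal_pow (norm_nonneg _), ← h4]
  erw [← h3]
  rw [ENNReal.ofReal_tsum_of_nonneg (fun i => by positivity) h.summable]
  simp only [← ofReal_norm, ← ENNReal.ofReal_pow (norm_nonneg _)]

/-- Both sides are the sum of the squared moduli of all matrix entries. In `ENNReal` the double sum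
may be swapped without any finiteness assumption. -/
theorem tsum_enorm_adjoint_sq {ι : Type*} (b : HilbertBasis ι ℂ E) (M : E →L[ℂ] E) :
    ∑' i, ‖star M (b i)‖ₑ ^ 2 = ∑' i, ‖M (b i)‖ₑ ^ 2 := by
  simp_rw [enorm_sq_eq_tsum_inner b]
  rw [ENNReal.tsum_comm]
  refine tsum_congr fun i => tsum_congr fun j => ?_
  rw [ContinuousLinearMap.star_eq_adjoint, ContinuousLinearMap.adjoint_inner_right,
    ← inner_conj_symm, RCLike.enorm_conj]

/-- The sum of the absolute values of the diagonal elements. -/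
noncomputable def diagNorm {ι : Type*} (b : HilbertBasis ι ℂ E) (T : E →L[ℂ] E) : ENNReal :=
  ∑' i, ‖⟪b i, T (b i)⟫_ℂ‖ₑ

theorem diagNorm_add_le {ι : Type*} (b : HilbertBasis ι ℂ E) (S T : E →L[ℂ] E) :
    diagNorm b (S + T) ≤ diagNorm b S + diagNorm b T := by
  unfold diagNorm
  rw [← ENNReal.tsum_add]
  refine ENNReal.tsum_le_tsum fun i => ?_
  rw [add_apply, inner_add_right]
  exact enorm_add_le _ _

theorem diagNorm_eq_tsum_sqrt {ι : Type*} (b : HilbertBasis ι ℂ E) {P : E →L[ℂ] E} (hP : 0 ≤ P) :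
    diagNorm b P = ∑' i, ‖CFC.sqrt P (b i)‖ₑ ^ 2 :=
  tsum_congr fun i => enorm_inner_apply hP (b i)

theorem diagNorm_mono {ι : Type*} (b : HilbertBasis ι ℂ E) {P Q : E →L[ℂ] E} (hP : 0 ≤ P)
    (h : P ≤ Q) : diagNorm b P ≤ diagNorm b Q := by
  refine ENNReal.tsum_le_tsum fun i => ?_
  rw [← ofReal_re_inner_apply hP, ← ofReal_re_inner_apply (hP.trans h)]
  refine ENNReal.ofReal_le_ofReal ?_
  have := re_inner_apply_nonneg (sub_nonneg.2 h) (b i)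
  rw [sub_apply, inner_sub_right, map_sub] at this
  linarith

/-- Lower semicontinuity in operator norm, since finite partial sums are continuous. It allows an
approximate polar decomposition to replace the exact one. -/
theorem diagNorm_le_of_approx {ι : Type*} (b : HilbertBasis ι ℂ E) (T : E →L[ℂ] E) (C : ENNReal)
    (h : ∀ ε : ℝ, 0 < ε → ∃ T' : E →L[ℂ] E, (∀ f, ‖T f - T' f‖ ≤ ε * ‖f‖) ∧ diagNorm b T' ≤ C) :
    diagNorm b T ≤ C := by
  unfold diagNorm
  rw [ENNReal.tsum_eq_iSup_sum]
  refine iSup_le fun F => ?_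
  have key : ∀ ε : ℝ, 0 < ε →
      ∑ i ∈ F, ‖⟪b i, T (b i)⟫_ℂ‖ₑ ≤ C + F.card * ENNReal.ofReal ε := by
    intro ε hε
    obtain ⟨T', h1, h2⟩ := h ε hε
    refine le_trans ?_ (add_le_add_left ((ENNReal.sum_le_tsum F).trans h2) _)
    rw [← nsmul_eq_mul, ← Finset.sum_const, ← Finset.sum_add_distrib]
    refine Finset.sum_le_sum fun i _ => ?_
    have h3 : ⟪b i, T (b i)⟫_ℂ = ⟪b i, T' (b i)⟫_ℂ + ⟪b i, T (b i) - T' (b i)⟫_ℂ := by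
      rw [inner_sub_right]; ring
    rw [h3]
    refine (enorm_add_le _ _).trans ?_
    gcongr
    rw [← ofReal_norm]
    refine ENNReal.ofReal_le_ofReal ((norm_inner_le_norm _ _).trans ?_)
    simpa [b.orthonormal.norm_eq_one i] using h1 (b i)
  have lim : Tendsto (fun ε : ℝ => C + F.card * ENNReal.ofReal ε) (𝓝[>] 0) (𝓝 C) := by
    have h1 : Tendsto (fun ε : ℝ => ENNReal.ofReal ε) (𝓝[>] 0) (𝓝 0) := by
      have := (ENNReal.continuous_ofReal.tendsto (0 : ℝ)).mono_left
        (nhdsWithin_le_nhds (s := Set.Ioi 0))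
      simpa using this
    have h2 := ENNReal.Tendsto.const_mul (a := (F.card : ENNReal)) h1
      (Or.inr (ENNReal.natCast_ne_top _))
    simpa using h2.const_add C
  exact ge_of_tendsto lim (eventually_nhdsWithin_of_forall fun ε hε => key ε hε)

/-- Factor `W P = (W S) S` with `S = P^{1/2}` and use `2ab ≤ a² + b²` on each diagonal entry. The
Hilbert-Schmidt norm of `(W S)*` is that of `W S`, hence at most that of `S`. -/
theorem diagNorm_mul_le {ι : Type*} (b : HilbertBasis ι ℂ E) {P : E →L[ℂ] E} (hP : 0 ≤ P)
    {W : E →L[ℂ] E} (hW : ‖W‖ ≤ 1) : diagNorm b (W * P) ≤ diagNorm b P := by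
  have hS : IsSelfAdjoint (CFC.sqrt P) := (CFC.sqrt_nonneg P).isSelfAdjoint
  set S := CFC.sqrt P with hSdef
  have h1 : ∀ i, 2 * ‖⟪b i, (W * P) (b i)⟫_ℂ‖ₑ ≤
      ‖star (W * S) (b i)‖ₑ ^ 2 + ‖S (b i)‖ₑ ^ 2 := by
    intro i
    have h2 : ⟪b i, (W * P) (b i)⟫_ℂ = ⟪star (W * S) (b i), S (b i)⟫_ℂ := by
      rw [ContinuousLinearMap.star_eq_adjoint, ContinuousLinearMap.adjoint_inner_left]
      conv_lhs => rw [← CFC.sqrt_mul_sqrt_self P hP]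
      rfl
    rw [h2]
    simp only [← ofReal_norm, ← ENNReal.ofReal_pow (norm_nonneg _)]
    rw [← ENNReal.ofReal_add (by positivity) (by positivity),
      show (2 : ENNReal) = ENNReal.ofReal 2 by simp, ← ENNReal.ofReal_mul (by norm_num)]
    refine ENNReal.ofReal_le_ofReal ?_
    have := norm_inner_le_norm (𝕜 := ℂ) (star (W * S) (b i)) (S (b i))
    nlinarith [sq_nonneg (‖star (W * S) (b i)‖ - ‖S (b i)‖)]
  have h2 := ENNReal.tsum_le_tsum h1
  rw [ENNReal.tsum_mul_left, ENNReal.tsum_add, tsum_enorm_adjoint_sq] at h2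
  have h3 : ∑' i, ‖(W * S) (b i)‖ₑ ^ 2 ≤ ∑' i, ‖S (b i)‖ₑ ^ 2 := by
    refine ENNReal.tsum_le_tsum fun i => ?_
    gcongr
    rw [← ofReal_norm, ← ofReal_norm]
    refine ENNReal.ofReal_le_ofReal ?_
    exact (W.le_opNorm _).trans (mul_le_of_le_one_left (norm_nonneg _) hW)
  have h4 : 2 * diagNorm b (W * P) ≤ 2 * diagNorm b P := by
    rw [diagNorm_eq_tsum_sqrt b hP, two_mul (tsum _)]
    exact h2.trans (add_le_add_left h3 _)
  exact (ENNReal.mul_le_mul_iff_right (by norm_num) (by norm_num)).1 h4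

/-! ### Resolvent bounds for a positive operator -/

section Resolvent

variable {P : E →L[ℂ] E}

theorem shift_apply (P : E →L[ℂ] E) (x : ℝ) (g : E) :
    (P + (x : ℂ) • 1) g = P g + (x : ℂ) • g := by
  simp

/-- For `x > 0` all three terms are nonnegative; dropping two of them gives the bounds on `P (P +
x)⁻¹` and `x (P + x)⁻¹`. -/
theorem norm_shift_apply_sq (hP : 0 ≤ P) (x : ℝ) (g : E) :
    ‖(P + (x : ℂ) • 1) g‖ ^ 2 =
      ‖P g‖ ^ 2 + 2 * x * RCLike.re ⟪g, P g⟫_ℂ + x ^ 2 * ‖g‖ ^ 2 := by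
  rw [shift_apply, norm_add_sq (𝕜 := ℂ), inner_smul_right, norm_smul, hP.isSelfAdjoint.isSymmetric.apply_clm]
  simp [mul_pow]
  ring

theorem isUnit_shift (hP : 0 ≤ P) {x : ℝ} (hx : 0 < x) : IsUnit (P + (x : ℂ) • 1) := by
  refine ContinuousLinearMap.isUnit_of_forall_le_norm_inner_map _ (c := ⟨x, hx.le⟩) hx fun g => ?_
  refine le_trans ?_ (Complex.re_le_norm _)
  rw [shift_apply, inner_add_left, inner_smul_left, inner_self_eq_norm_sq_to_K,
    hP.isSelfAdjoint.isSymmetric.apply_clm]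
  have := re_inner_apply_nonneg hP g
  rw [Complex.add_re, Complex.conj_ofReal]
  have h2 : ((x : ℂ) * ((‖g‖ : ℝ) : ℂ) ^ 2).re = x * ‖g‖ ^ 2 := by
    rw [← Complex.ofReal_pow, ← Complex.ofReal_mul, Complex.ofReal_re]
  erw [h2]
  change ‖g‖ ^ 2 * x ≤ _
  have h3 : 0 ≤ (⟪g, P g⟫_ℂ).re := this
  linarith

theorem shift_mul_resolvent (hP : 0 ≤ P) {x : ℝ} (hx : 0 < x) :
    (P + (x : ℂ) • 1) * resolvent P x = 1 :=
  Ring.mul_inverse_cancel _ (isUnit_shift hP hx)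

theorem resolvent_mul_shift (hP : 0 ≤ P) {x : ℝ} (hx : 0 < x) :
    resolvent P x * (P + (x : ℂ) • 1) = 1 :=
  Ring.inverse_mul_cancel _ (isUnit_shift hP hx)

theorem shift_resolvent_apply (hP : 0 ≤ P) {x : ℝ} (hx : 0 < x) (g : E) :
    (P + (x : ℂ) • 1) (resolvent P x g) = g :=
  DFunLike.congr_fun (shift_mul_resolvent hP hx) g

theorem norm_mul_resolvent_apply_le (hP : 0 ≤ P) {x : ℝ} (hx : 0 < x) (g : E) :
    ‖P (resolvent P x g)‖ ≤ ‖g‖ := by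
  have h := norm_shift_apply_sq hP x (resolvent P x g)
  rw [shift_resolvent_apply hP hx] at h
  have h2 := re_inner_apply_nonneg hP (resolvent P x g)
  refine le_of_sq_le_sq ?_ (norm_nonneg _)
  rw [h]
  have := mul_nonneg hx.le h2
  nlinarith [sq_nonneg (x * ‖resolvent P x g‖)]

theorem norm_smul_resolvent_apply_le (hP : 0 ≤ P) {x : ℝ} (hx : 0 < x) (g : E) :
    x * ‖resolvent P x g‖ ≤ ‖g‖ := by
  have h := norm_shift_apply_sq hP x (resolvent P x g)
  rw [shift_resolvent_apply hP hx] at h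
  have h2 := re_inner_apply_nonneg hP (resolvent P x g)
  refine le_of_sq_le_sq ?_ (norm_nonneg _)
  rw [h]
  have := mul_nonneg hx.le h2
  nlinarith [sq_nonneg ‖P (resolvent P x g)‖]

theorem commute_resolvent {Q : E →L[ℂ] E} (h : Commute Q P) (x : ℝ) : Commute Q (resolvent P x) := by
  have hc : Commute Q (P + (x : ℂ) • 1) := Commute.add_right h ((Commute.one_right Q).smul_right _)
  by_cases hu : IsUnit (P + (x : ℂ) • 1)
  · obtain ⟨u, hu⟩ := hu
    rw [resolvent, ← hu, Ring.inverse_unit]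
    exact (hu ▸ hc : Commute Q u).units_inv_right
  · rw [resolvent, Ring.inverse_non_unit _ hu]
    exact Commute.zero_right Q

theorem isSelfAdjoint_resolvent (hP : IsSelfAdjoint P) (x : ℝ) :
    IsSelfAdjoint (resolvent P x) := by
  rw [resolvent, isSelfAdjoint_iff, ← Ring.inverse_star, star_add, hP.star_eq, star_smul, star_one]
  simp

end Resolvent

/-- The contraction `T (|T| + ε)⁻¹`, an approximation of the partial isometry of the polar
decomposition. -/
noncomputable def approxPolar (T : E →L[ℂ] E) (ε : ℝ) : E →L[ℂ] E := T * resolvent (CFC.abs T) ε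

theorem norm_abs_apply (T : E →L[ℂ] E) (f : E) : ‖CFC.abs T f‖ = ‖T f‖ := by
  have h : IsSelfAdjoint (CFC.abs T) := (CFC.abs_nonneg T).isSelfAdjoint
  have h1 : ⟪CFC.abs T f, CFC.abs T f⟫_ℂ = ⟪T f, T f⟫_ℂ := by
    rw [h.isSymmetric.apply_clm, ← ContinuousLinearMap.adjoint_inner_right T]
    have := DFunLike.congr_fun (CFC.abs_mul_abs T) f
    rw [ContinuousLinearMap.star_eq_adjoint] at this
    exact congrArg _ this
  rw [inner_self_eq_norm_sq_to_K, inner_self_eq_norm_sq_to_K] at h1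
  have h2 : ‖CFC.abs T f‖ ^ 2 = ‖T f‖ ^ 2 := by exact_mod_cast h1
  exact (sq_eq_sq₀ (norm_nonneg _) (norm_nonneg _)).1 h2

theorem norm_approxPolar_le (T : E →L[ℂ] E) {ε : ℝ} (hε : 0 < ε) : ‖approxPolar T ε‖ ≤ 1 := by
  refine ContinuousLinearMap.opNorm_le_bound _ zero_le_one fun f => ?_
  rw [approxPolar, mul_apply_eq_comp, ← norm_abs_apply, one_mul]
  exact norm_mul_resolvent_apply_le (CFC.abs_nonneg T) hε f

theorem resolvent_mul_self {P : E →L[ℂ] E} (hP : 0 ≤ P) {ε : ℝ} (hε : 0 < ε) :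
    resolvent P ε * P = 1 - (ε : ℂ) • resolvent P ε := by
  have h := resolvent_mul_shift hP hε
  rw [mul_add, mul_smul_comm, mul_one] at h
  exact eq_sub_of_add_eq h

theorem sub_approxPolar_mul_abs (T : E →L[ℂ] E) {ε : ℝ} (hε : 0 < ε) (f : E) :
    ‖T f - (approxPolar T ε * CFC.abs T) f‖ ≤ ε * ‖f‖ := by
  have h : T - approxPolar T ε * CFC.abs T = (ε : ℂ) • approxPolar T ε := by
    rw [approxPolar, mul_assoc, resolvent_mul_self (CFC.abs_nonneg T) hε, mul_sub, mul_one,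
      mul_smul_comm, sub_sub_cancel]
  rw [← sub_apply, h, smul_apply, norm_smul]
  have h1 : ‖(ε : ℂ)‖ = ε := by simp [abs_of_pos hε]
  rw [h1]
  gcongr
  exact ((approxPolar T ε).le_opNorm f).trans
    (mul_le_of_le_one_left (norm_nonneg _) (norm_approxPolar_le T hε))

/-- Since `T* T = |T|²`, the product is `(|T| + ε)⁻¹ |T|²`, which differs from `|T|` by `ε |T| (|T|
+ ε)⁻¹`. -/
theorem abs_sub_star_approxPolar_mul (T : E →L[ℂ] E) {ε : ℝ} (hε : 0 < ε) (f : E) :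
    ‖CFC.abs T f - (star (approxPolar T ε) * T) f‖ ≤ ε * ‖f‖ := by
  have hA := CFC.abs_nonneg T
  have hc : Commute (CFC.abs T) (resolvent (CFC.abs T) ε) := commute_resolvent (Commute.refl _) ε
  have h : CFC.abs T - star (approxPolar T ε) * T =
      (ε : ℂ) • (CFC.abs T * resolvent (CFC.abs T) ε) := by
    rw [approxPolar, star_mul, (isSelfAdjoint_resolvent hA.isSelfAdjoint ε).star_eq, mul_assoc,
      ← CFC.abs_mul_abs, ← mul_assoc, resolvent_mul_self hA hε, sub_mul, one_mul,
      smul_mul_assoc, sub_sub_cancel, hc.eq]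
  rw [← sub_apply, h, smul_apply, norm_smul]
  have h1 : ‖(ε : ℂ)‖ = ε := by simp [abs_of_pos hε]
  rw [h1]
  gcongr
  exact norm_mul_resolvent_apply_le hA hε f

theorem traceNorm_eq (T : E →L[ℂ] E) :
    traceNorm T = ⨆ (w : Set E) (b : HilbertBasis w ℂ E), diagNorm b (CFC.abs T) := by
  unfold traceNorm diagNorm
  simp_rw [ofReal_re_inner_apply (CFC.abs_nonneg T)]

theorem diagNorm_abs_le {w : Set E} (b : HilbertBasis w ℂ E) (T : E →L[ℂ] E) :
    diagNorm b (CFC.abs T) ≤ traceNorm T := by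
  rw [traceNorm_eq]
  exact le_iSup₂_of_le w b le_rfl

theorem diagNorm_mul_le_traceNorm {w : Set E} (b : HilbertBasis w ℂ E) (T : E →L[ℂ] E)
    {W : E →L[ℂ] E} (hW : ‖W‖ ≤ 1) : diagNorm b (W * T) ≤ traceNorm T := by
  refine (diagNorm_le_of_approx b _ _ fun ε hε =>
    ⟨W * approxPolar T ε * CFC.abs T, fun f => ?_, diagNorm_mul_le b (CFC.abs_nonneg T) ?_⟩).trans
    (diagNorm_abs_le b T)
  · have h : (W * T) f - (W * approxPolar T ε * CFC.abs T) f =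
        W (T f - (approxPolar T ε * CFC.abs T) f) := by
      rw [map_sub, mul_assoc]; rfl
    rw [h]
    exact (W.le_opNorm _).trans ((mul_le_of_le_one_left (norm_nonneg _) hW).trans
      (sub_approxPolar_mul_abs T hε f))
  · exact (norm_mul_le _ _).trans (mul_le_one₀ hW (norm_nonneg _) (norm_approxPolar_le T hε))

theorem diagNorm_le_traceNorm {w : Set E} (b : HilbertBasis w ℂ E) (T : E →L[ℂ] E) :
    diagNorm b T ≤ traceNorm T := by
  have h : ‖(1 : E →L[ℂ] E)‖ ≤ 1 := ContinuousLinearMap.norm_id_le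
  simpa using diagNorm_mul_le_traceNorm b T h

/-- `|S + T|` is a limit of `U* (S + T)` with contractions `U`, and this expression is additive in
`S` and `T`. -/
theorem traceNorm_add_le (S T : E →L[ℂ] E) : traceNorm (S + T) ≤ traceNorm S + traceNorm T := by
  rw [traceNorm_eq (S + T)]
  refine iSup₂_le fun w b => diagNorm_le_of_approx b _ _ fun ε hε =>
    ⟨star (approxPolar (S + T) ε) * (S + T), abs_sub_star_approxPolar_mul _ hε, ?_⟩
  have h : ‖star (approxPolar (S + T) ε)‖ ≤ 1 := by
    rw [norm_star]; exact norm_approxPolar_le _ hε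
  rw [mul_add]
  exact (diagNorm_add_le _ _ _).trans
    (add_le_add (diagNorm_mul_le_traceNorm b S h) (diagNorm_mul_le_traceNorm b T h))

theorem traceNorm_neg (T : E →L[ℂ] E) : traceNorm (-T) = traceNorm T := by
  simp only [traceNorm, CFC.abs_neg]

theorem traceNorm_of_nonneg {P : E →L[ℂ] E} (hP : 0 ≤ P) :
    traceNorm P = ⨆ (w : Set E) (b : HilbertBasis w ℂ E), diagNorm b P := by
  rw [traceNorm_eq, CFC.abs_of_nonneg P hP]

theorem traceNorm_mono {P Q : E →L[ℂ] E} (hP : 0 ≤ P) (h : P ≤ Q) : traceNorm P ≤ traceNorm Q := by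
  rw [traceNorm_of_nonneg hP, traceNorm_of_nonneg (hP.trans h)]
  exact iSup₂_mono fun w b => diagNorm_mono b hP h

theorem traceNorm_abs (T : E →L[ℂ] E) : traceNorm (CFC.abs T) = traceNorm T := by
  rw [traceNorm_of_nonneg (CFC.abs_nonneg T), traceNorm_eq]

theorem isTraceClass_posPart {A : E →L[ℂ] E} (hA : IsSelfAdjoint A) (ht : IsTraceClass A) :
    IsTraceClass A⁺ ∧ IsTraceClass A⁻ := by
  have h := CFC.posPart_add_negPart A hA
  have hp := CFC.posPart_nonneg A
  have hn := CFC.negPart_nonneg A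
  constructor
  · refine ne_top_of_le_ne_top ht ((traceNorm_mono hp ?_).trans (traceNorm_abs A).le)
    rw [← h]; exact le_add_of_nonneg_right hn
  · refine ne_top_of_le_ne_top ht ((traceNorm_mono hn ?_).trans (traceNorm_abs A).le)
    rw [← h]; exact le_add_of_nonneg_left hp

theorem enorm_inner_abs_le {T : E →L[ℂ] E} {f : E} (hf : ‖f‖ = 1) :
    ‖⟪f, CFC.abs T f⟫_ℂ‖ₑ ≤ traceNorm T := by
  have ho : Orthonormal ℂ (Subtype.val : ({f} : Set E) → E) := by
    constructor
    · rintro ⟨i, rfl⟩; exact hf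
    · intro i j hij; exact absurd (Subsingleton.elim i j) hij
  obtain ⟨w, b, hw, hb⟩ := ho.exists_hilbertBasis_extension
  refine le_trans ?_ (diagNorm_abs_le b T)
  have := ENNReal.le_tsum (f := fun i => ‖⟪b i, CFC.abs T (b i)⟫_ℂ‖ₑ) ⟨f, hw rfl⟩
  simpa [diagNorm, hb] using this

/-- Any unit vector extends to an orthonormal basis, so `‖|T|^{1/2} f‖²` is at most the trace norm;
moreover `‖T‖ = ‖|T|‖ ≤ ‖|T|^{1/2}‖²`. -/
theorem enorm_le_traceNorm (T : E →L[ℂ] E) : ‖T‖ₑ ≤ traceNorm T := by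
  by_cases ht : traceNorm T = ⊤
  · simp [ht]
  obtain ⟨t, ht'⟩ := Option.ne_none_iff_exists'.1 ht
  replace ht' : (t : ENNReal) = traceNorm T := ht'.symm
  have hA := CFC.abs_nonneg T
  have hunit : ∀ f : E, ‖f‖ = 1 → ‖CFC.sqrt (CFC.abs T) f‖ ^ 2 ≤ t := by
    intro f hf
    have h := enorm_inner_abs_le (T := T) hf
    rw [enorm_inner_apply hA, ← ht', ← ofReal_norm,
      ← ENNReal.ofReal_pow (norm_nonneg _)] at h
    have := ENNReal.toReal_mono ENNReal.coe_ne_top h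
    rwa [ENNReal.toReal_ofReal (by positivity)] at this
  have hS : ‖CFC.sqrt (CFC.abs T)‖ ≤ Real.sqrt t := by
    refine ContinuousLinearMap.opNorm_le_of_unit_norm (𝕜 := ℂ) (Real.sqrt_nonneg _) fun f hf => ?_
    exact Real.le_sqrt_of_sq_le (hunit f hf)
  have h1 : ‖T‖ ≤ t := by
    rw [← CFC.norm_abs (a := T), ← CFC.sqrt_mul_sqrt_self (CFC.abs T) hA]
    refine (norm_mul_le _ _).trans ?_
    calc _ ≤ Real.sqrt t * Real.sqrt t := by gcongr
      _ = t := Real.mul_self_sqrt t.2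
  rw [← ht', ← ofReal_norm]
  refine (ENNReal.ofReal_le_ofReal h1).trans ?_
  simp

end TraceNorm

/-! ### Differentiating a trace-norm power series -/

section Analytic

open Filter Topology

/-- Convergence of the partial sums forces the terms to zero, so the radius of convergence is at
least `r / 2`, and there the sum of the power series is `f (x + y)`. -/
theorem hasDerivAt_of_tendsto_partial_sums {F : Type*} [NormedAddCommGroup F] [NormedSpace ℝ F]
    [CompleteSpace F] {f : ℝ → F} {x r : ℝ} (hr : 0 < r) {a : ℕ → F}
    (h : ∀ y, |y| < r → Tendsto (fun N : ℕ => ∑ n ∈ Finset.range N, y ^ n • a n) atTop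
      (𝓝 (f (x + y)))) : HasDerivAt f (a 1) x := by
  set p : FormalMultilinearSeries ℝ ℝ F :=
    fun n => ContinuousMultilinearMap.mkPiRing ℝ (Fin n) (a n) with hp
  have hnorm : ∀ n, ‖p n‖ = ‖a n‖ := fun n => by simp [hp]
  have hterm : ∀ y, |y| < r → Tendsto (fun n => y ^ n • a n) atTop (𝓝 0) := by
    intro y hy
    have h1 := ((h y hy).comp (tendsto_add_atTop_nat 1)).sub (h y hy)
    simpa [Finset.sum_range_succ] using h1
  have hrad : ∀ y : ℝ, 0 ≤ y → y < r → ENNReal.ofReal y ≤ p.radius := by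
    intro y hy0 hy
    refine p.le_radius_of_tendsto (l := 0) ?_
    have := (hterm y (by rwa [abs_of_nonneg hy0])).norm
    simp only [norm_smul, norm_pow, norm_zero] at this
    refine this.congr fun n => ?_
    rw [hnorm, Real.norm_of_nonneg hy0, Real.coe_toNNReal y hy0, mul_comm]
  have hr2 := hrad (r / 2) (half_pos hr).le (half_lt_self hr)
  have hpos : 0 < p.radius := lt_of_lt_of_le (ENNReal.ofReal_pos.2 (half_pos hr)) hr2
  have hball := p.hasFPowerSeriesOnBall hpos
  have hd := hball.hasFPowerSeriesAt.hasDerivAt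
  have heq : ∀ᶠ y in 𝓝 (0 : ℝ), p.sum y = f (x + y) := by
    have h1 : ∀ᶠ y in 𝓝 (0 : ℝ), |y| < r / 2 := by
      have := Metric.ball_mem_nhds (0 : ℝ) (half_pos hr)
      filter_upwards [this] with y hy
      simpa using hy
    filter_upwards [h1] with y hy
    have hmem : y ∈ Metric.eball (0 : ℝ) p.radius := by
      rw [Metric.mem_eball, edist_zero_right]
      refine lt_of_lt_of_le ?_ hr2
      rw [← ofReal_norm, Real.norm_eq_abs]
      exact (ENNReal.ofReal_lt_ofReal_iff (half_pos hr)).2 hy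
    have h2 := (hball.hasSum hmem).tendsto_sum_nat
    rw [zero_add] at h2
    refine tendsto_nhds_unique h2 ?_
    refine (h y (by linarith)).congr fun N => Finset.sum_congr rfl fun n _ => ?_
    simp [hp]
  have h3 : HasDerivAt (fun y => f (x + y)) (a 1) 0 := by
    refine (hd.congr_of_eventuallyEq (heq.mono fun y hy => hy.symm)).congr_deriv ?_
    simp [hp]
  have h4 := HasDerivAt.comp_const_add (-x) x (f := fun y => f (x + y)) (f' := a 1)
    (by simpa using h3)
  simpa using h4

variable {E : Type*} [NormedAddCommGroup E] [InnerProductSpace ℂ E] [CompleteSpace E]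

theorem summable_diag {w : Set E} (b : HilbertBasis w ℂ E) {T : E →L[ℂ] E} (hT : IsTraceClass T) :
    Summable fun i => ⟪b i, T (b i)⟫_ℂ := by
  refine Summable.of_enorm ?_
  exact ne_top_of_le_ne_top hT (diagNorm_le_traceNorm b T)

theorem enorm_tsum_diag_le {w : Set E} (b : HilbertBasis w ℂ E) (T : E →L[ℂ] E) :
    ‖∑' i, ⟪b i, T (b i)⟫_ℂ‖ₑ ≤ traceNorm T :=
  enorm_tsum_le_tsum_enorm.trans (diagNorm_le_traceNorm b T)

theorem tendsto_of_tendsto_enorm_sub {F : Type*} [SeminormedAddCommGroup F] {u : ℕ → F} {l : F}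
    {c : ℕ → ENNReal} (hc : Tendsto c atTop (𝓝 0)) (h : ∀ n, ‖l - u n‖ₑ ≤ c n) :
    Tendsto u atTop (𝓝 l) := by
  rw [tendsto_iff_edist_tendsto_0]
  refine tendsto_of_tendsto_of_tendsto_of_le_of_le tendsto_const_nhds hc (fun _ => zero_le) ?_
  intro n
  change edist (u n) l ≤ c n
  rw [edist_comm, edist_eq_enorm_sub]
  exact h n

/-- A family of states that is analytic in trace norm has a trace class derivative of trace zero. -/
theorem exists_hasDerivAt_trace_zero {I : Set ℝ} (hI : IsOpen I) {ρ : ℝ → E →L[ℂ] E}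
    (hs : ∀ θ ∈ I, IsState (ρ θ)) (ha : IsTraceNormAnalyticOn ρ I) {θ : ℝ} (hθ : θ ∈ I) :
    ∃ A : E →L[ℂ] E, HasDerivAt ρ A θ ∧ IsTraceClass A ∧ HasTrace A 0 := by
  obtain ⟨r, hr, a, hac, hlim⟩ := ha θ hθ
  obtain ⟨δ, hδ, hball⟩ := Metric.isOpen_iff.1 hI θ hθ
  have hmem : ∀ y, |y| < min r δ → θ + y ∈ I := fun y hy =>
    hball (by simpa using lt_of_lt_of_le hy (min_le_right _ _))
  have hlim' : ∀ y, |y| < min r δ → Tendsto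
      (fun N : ℕ => traceNorm (ρ (θ + y) - ∑ n ∈ Finset.range N, ((y : ℂ) ^ n) • a n))
        atTop (𝓝 0) := by
    intro y hy
    have := hlim (θ + y) (hmem y hy) (by simpa using lt_of_lt_of_le hy (min_le_left _ _))
    simpa using this
  have hpos : 0 < min r δ := lt_min hr hδ
  refine ⟨a 1, ?_, hac 1, ?_⟩
  · refine hasDerivAt_of_tendsto_partial_sums hpos fun y hy => ?_
    refine tendsto_of_tendsto_enorm_sub (hlim' y hy) fun N => ?_
    have : ∑ n ∈ Finset.range N, y ^ n • a n = ∑ n ∈ Finset.range N, ((y : ℂ) ^ n) • a n :=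
      Finset.sum_congr rfl fun n _ => by
        rw [← Complex.ofReal_pow]; rfl
    rw [this]
    exact enorm_le_traceNorm _
  · intro w b
    -- The diagonal sum is bounded by the trace norm, so the traces of the coefficients form a power
    -- series for the constant `Tr ρ = 1`; its linear coefficient must vanish.
    have hd : HasDerivAt (fun _ : ℝ => (1 : ℂ)) (∑' i, ⟪b i, a 1 (b i)⟫_ℂ) θ := by
      refine hasDerivAt_of_tendsto_partial_sums (a := fun n => ∑' i, ⟪b i, a n (b i)⟫_ℂ)
        hpos fun y hy => ?_
      refine tendsto_of_tendsto_enorm_sub (hlim' y hy) fun N => ?_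
      refine le_trans (le_of_eq ?_) (enorm_tsum_diag_le b _)
      congr 1
      have h1 := (hs _ (hmem y hy)).trace_one w b
      have h2 := hasSum_sum (s := Finset.range N) fun n _ =>
        ((summable_diag b (hac n)).hasSum.mul_left ((y : ℂ) ^ n))
      have h3 : ∑' i, ⟪b i, (ρ (θ + y) - ∑ n ∈ Finset.range N, ((y : ℂ) ^ n) • a n) (b i)⟫_ℂ =
          1 - ∑ n ∈ Finset.range N, (y : ℂ) ^ n * ∑' i, ⟪b i, a n (b i)⟫_ℂ := by
        rw [← (h1.sub h2).tsum_eq]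
        refine tsum_congr fun i => ?_
        simp
      rw [h3]
      congr 1
      refine Finset.sum_congr rfl fun n _ => ?_
      rw [← Complex.ofReal_pow, Complex.real_smul]
    have h0 : ∑' i, ⟪b i, a 1 (b i)⟫_ℂ = 0 := hd.unique (hasDerivAt_const θ (1 : ℂ))
    rw [← h0]
    exact (summable_diag b (hac 1)).hasSum

theorem isSelfAdjoint_of_hasDerivAt {I : Set ℝ} (hI : IsOpen I) {ρ : ℝ → E →L[ℂ] E}
    (hs : ∀ θ ∈ I, IsSelfAdjoint (ρ θ)) {θ : ℝ} (hθ : θ ∈ I) {A : E →L[ℂ] E}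
    (hd : HasDerivAt ρ A θ) : IsSelfAdjoint A := by
  have h1 : HasDerivAt (fun t => star (ρ t)) (star A) θ := hd.star
  have h2 : HasDerivAt (fun t => star (ρ t)) A θ :=
    hd.congr_of_eventuallyEq (Filter.eventuallyEq_of_mem (hI.mem_nhds hθ) fun t ht => (hs t ht).star_eq)
  exact h1.unique h2

end Analytic

/-! ### Averages `∫ B(x) A B(x) dμ(x)` preserve the trace -/

section Sandwich

open Filter Topology MeasureTheory

variable {E : Type*} [NormedAddCommGroup E] [InnerProductSpace ℂ E] [CompleteSpace E]

/-- A measurable family of self-adjoint operators with `∫ B(x)² dμ(x) = 1`. -/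
structure IsSandwichFamily (μ : Measure ℝ) (B : ℝ → E →L[ℂ] E) : Prop where
  selfAdjoint : ∀ x, IsSelfAdjoint (B x)
  aestronglyMeasurable : ∀ f, AEStronglyMeasurable (fun x => B x f) μ
  lintegral_sq : ∀ f, ∫⁻ x, ‖B x f‖ₑ ^ 2 ∂μ = ‖f‖ₑ ^ 2

namespace IsSandwichFamily

variable {μ : Measure ℝ} {B : ℝ → E →L[ℂ] E}

theorem eLpNorm_eq (hB : IsSandwichFamily μ B) (f : E) : eLpNorm (fun x => B x f) 2 μ = ‖f‖ₑ := by
  rw [eLpNorm_eq_lintegral_rpow_enorm_toReal (by norm_num) (by norm_num)]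
  have h := hB.lintegral_sq f
  simp only [ENNReal.toReal_ofNat, ENNReal.rpow_ofNat]
  rw [h, ← ENNReal.rpow_natCast, ← ENNReal.rpow_mul]
  simp

theorem memLp (hB : IsSandwichFamily μ B) (f : E) : MemLp (fun x => B x f) 2 μ :=
  ⟨hB.aestronglyMeasurable f, by rw [hB.eLpNorm_eq]; exact enorm_lt_top⟩

/-- The isometry `f ↦ (x ↦ B(x) f)` of `E` into `L²(μ; E)`. -/
noncomputable def embed (hB : IsSandwichFamily μ B) : E →ₗᵢ[ℂ] Lp E 2 μ where
  toFun f := (hB.memLp f).toLp _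
  map_add' f g := by
    rw [← MemLp.toLp_add]
    congr 1
    ext x
    simp
  map_smul' c f := by
    rw [RingHom.id_apply, ← MemLp.toLp_const_smul]
    congr 1
    ext x
    simp
  norm_map' f := by
    change ‖(hB.memLp f).toLp _‖ = ‖f‖
    rw [Lp.norm_toLp, hB.eLpNorm_eq, toReal_enorm]

theorem coeFn_embed (hB : IsSandwichFamily μ B) (f : E) : hB.embed f =ᵐ[μ] fun x => B x f :=
  (hB.memLp f).coeFn_toLp

/-- The average `∫ B(x) A B(x) dμ(x)`. -/
noncomputable def average (hB : IsSandwichFamily μ B) (A : E →L[ℂ] E) : E →L[ℂ] E :=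
  ContinuousLinearMap.adjoint hB.embed.toContinuousLinearMap ∘L A.compLpL 2 μ ∘L
    hB.embed.toContinuousLinearMap

theorem inner_average_aux (hB : IsSandwichFamily μ B) (A : E →L[ℂ] E) (f g : E) :
    ⟪f, hB.average A g⟫_ℂ = ⟪hB.embed f, A.compLpL 2 μ (hB.embed g)⟫_ℂ :=
  ContinuousLinearMap.adjoint_inner_right hB.embed.toContinuousLinearMap f
    (A.compLpL 2 μ (hB.embed g))

theorem inner_ae (hB : IsSandwichFamily μ B) (A : E →L[ℂ] E) (f g : E) :
    (fun x => ⟪hB.embed f x, A.compLpL 2 μ (hB.embed g) x⟫_ℂ) =ᵐ[μ]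
      fun x => ⟪B x f, A (B x g)⟫_ℂ := by
  filter_upwards [hB.coeFn_embed f, hB.coeFn_embed g, A.coeFn_compLpL (hB.embed g)] with x h1 h2 h3
  rw [h3, h1, h2]

theorem inner_average (hB : IsSandwichFamily μ B) (A : E →L[ℂ] E) (f g : E) :
    ⟪f, hB.average A g⟫_ℂ = ∫ x, ⟪B x f, A (B x g)⟫_ℂ ∂μ := by
  rw [inner_average_aux, L2.inner_def]
  exact integral_congr_ae (hB.inner_ae A f g)

theorem integrable_inner (hB : IsSandwichFamily μ B) (A : E →L[ℂ] E) (f g : E) :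
    Integrable (fun x => ⟪B x f, A (B x g)⟫_ℂ) μ :=
  (L2.integrable_inner _ _).congr (hB.inner_ae A f g)

theorem average_sub (hB : IsSandwichFamily μ B) (A A' : E →L[ℂ] E) :
    hB.average (A - A') = hB.average A - hB.average A' := by
  ext g
  refine ext_inner_left ℂ fun f => ?_
  rw [sub_apply, inner_sub_right]
  simp only [inner_average]
  rw [← integral_sub (hB.integrable_inner A f g) (hB.integrable_inner A' f g)]
  simp

theorem inner_average_one (hB : IsSandwichFamily μ B) (f g : E) :
    ∫ x, ⟪B x f, B x g⟫_ℂ ∂μ = ⟪f, g⟫_ℂ := by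
  rw [← hB.embed.inner_map_map, L2.inner_def]
  refine (integral_congr_ae ?_).symm
  filter_upwards [hB.coeFn_embed f, hB.coeFn_embed g] with x h1 h2
  rw [h1, h2]

theorem average_add_smul_one (hB : IsSandwichFamily μ B) (A : E →L[ℂ] E) (c : ℂ) :
    hB.average (A + c • 1) = hB.average A + c • 1 := by
  ext g
  refine ext_inner_left ℂ fun f => ?_
  rw [add_apply, inner_add_right]
  simp only [inner_average]
  have h1 := hB.integrable_inner 1 f g
  simp only [add_apply, smul_apply, one_apply_eq_self, inner_add_right, inner_smul_right] at h1 ⊢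
  rw [integral_add (hB.integrable_inner A f g) (h1.const_mul c), integral_const_mul,
    hB.inner_average_one]

theorem isSelfAdjoint_average (hB : IsSandwichFamily μ B) {A : E →L[ℂ] E} (hA : IsSelfAdjoint A) :
    IsSelfAdjoint (hB.average A) := by
  rw [ContinuousLinearMap.isSelfAdjoint_iff_isSymmetric]
  intro f g
  change ⟪hB.average A f, g⟫_ℂ = ⟪f, hB.average A g⟫_ℂ
  rw [← inner_conj_symm, inner_average, inner_average, ← integral_conj]
  refine integral_congr_ae (ae_of_all _ fun x => ?_)
  change starRingEnd ℂ ⟪B x g, A (B x f)⟫_ℂ = ⟪B x f, A (B x g)⟫_ℂ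
  rw [inner_conj_symm, hA.isSymmetric.apply_clm]

theorem average_nonneg (hB : IsSandwichFamily μ B) {A : E →L[ℂ] E} (hA : 0 ≤ A) :
    0 ≤ hB.average A := by
  rw [ContinuousLinearMap.nonneg_iff_isPositive, ContinuousLinearMap.isPositive_iff_complex]
  intro f
  have h : ⟪hB.average A f, f⟫_ℂ = ((∫ x, ‖CFC.sqrt A (B x f)‖ ^ 2 ∂μ : ℝ) : ℂ) := by
    rw [(hB.isSelfAdjoint_average hA.isSelfAdjoint).isSymmetric.apply_clm, inner_average,
      ← integral_complex_ofReal]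
    simp_rw [inner_apply_eq_norm_sqrt_sq hA]
  erw [h]
  refine ⟨by simp, ?_⟩
  rw [RCLike.re_eq_complex_re, Complex.ofReal_re]
  exact integral_nonneg fun x => by positivity

theorem enorm_inner_average (hB : IsSandwichFamily μ B) {P : E →L[ℂ] E} (hP : 0 ≤ P) (f : E) :
    ‖⟪f, hB.average P f⟫_ℂ‖ₑ = ∫⁻ x, ‖CFC.sqrt P (B x f)‖ₑ ^ 2 ∂μ := by
  have h1 : ⟪f, hB.average P f⟫_ℂ = ((∫ x, ‖CFC.sqrt P (B x f)‖ ^ 2 ∂μ : ℝ) : ℂ) := by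
    rw [inner_average, ← integral_complex_ofReal]
    simp_rw [inner_apply_eq_norm_sqrt_sq hP]
  have h2 : Integrable (fun x => ‖CFC.sqrt P (B x f)‖ ^ 2) μ := by
    refine (hB.integrable_inner P f f).re.congr (ae_of_all _ fun x => ?_)
    change RCLike.re ⟪B x f, P (B x f)⟫_ℂ = _
    rw [inner_apply_eq_norm_sqrt_sq hP, RCLike.re_eq_complex_re, Complex.ofReal_re]
  rw [h1, ← ofReal_norm, Complex.norm_real,
    Real.norm_of_nonneg (integral_nonneg fun x => by positivity),
    ofReal_integral_eq_lintegral_ofReal h2 (ae_of_all _ fun x => by positivity)]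
  simp_rw [← ofReal_norm, ← ENNReal.ofReal_pow (norm_nonneg _)]

/-- With `S = P^{1/2}`, the trace of the average is `∫ ‖S B(x)‖₂² dμ = ∫ ‖B(x) S‖₂² dμ = ∑ ‖S bᵢ‖²`.
Countability of the basis is what permits exchanging sum and integral. -/
theorem diagNorm_average (hB : IsSandwichFamily μ B) {ι : Type*} [Countable ι]
    (b : HilbertBasis ι ℂ E) {P : E →L[ℂ] E} (hP : 0 ≤ P) :
    diagNorm b (hB.average P) = diagNorm b P := by
  set S := CFC.sqrt P with hS
  have hSa : IsSelfAdjoint S := (CFC.sqrt_nonneg P).isSelfAdjoint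
  have hm : ∀ (M : E →L[ℂ] E) (f : E), AEMeasurable (fun x => ‖M (B x f)‖ₑ ^ 2) μ := fun M f =>
    ((M.continuous.comp_aestronglyMeasurable (hB.aestronglyMeasurable f)).enorm).pow_const 2
  have h : ∀ x, ∑' i, ‖S (B x (b i))‖ₑ ^ 2 = ∑' i, ‖B x (S (b i))‖ₑ ^ 2 := by
    intro x
    have := tsum_enorm_adjoint_sq b (S * B x)
    rw [star_mul, hSa.star_eq, (hB.selfAdjoint x).star_eq] at this
    exact this.symm
  rw [diagNorm_eq_tsum_sqrt b hP]
  unfold diagNorm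
  simp_rw [hB.enorm_inner_average hP]
  rw [← lintegral_tsum fun i => hm S (b i)]
  simp_rw [h]
  rw [lintegral_tsum fun i => ((hB.aestronglyMeasurable (S (b i))).enorm).pow_const 2]
  exact tsum_congr fun i => hB.lintegral_sq _

end IsSandwichFamily

/-- Distinct basis vectors are at distance at least `1`, so the balls of radius `1 / 2` around them
are disjoint. -/
theorem HilbertBasis.countable_index [TopologicalSpace.SeparableSpace E] {ι : Type*}
    (b : HilbertBasis ι ℂ E) : Countable ι := by
  have hd : ∀ i j, i ≠ j → 1 ≤ dist (b i) (b j) := by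
    intro i j hij
    have h := norm_sub_sq (𝕜 := ℂ) (b i) (b j)
    rw [b.orthonormal.2 hij, b.orthonormal.norm_eq_one, b.orthonormal.norm_eq_one] at h
    rw [dist_eq_norm]
    norm_num at h
    nlinarith [norm_nonneg (b i - b j)]
  have hdisj : (Set.univ : Set ι).PairwiseDisjoint fun i => Metric.ball (b i) (1 / 2) := by
    intro i _ j _ hij
    refine Metric.ball_disjoint_ball ?_
    have := hd i j hij
    linarith
  rw [← Set.countable_univ_iff]
  exact hdisj.countable_of_isOpen (fun i _ => Metric.isOpen_ball)
    fun i _ => ⟨b i, Metric.mem_ball_self (by norm_num)⟩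

namespace IsSandwichFamily

variable {μ : Measure ℝ} {B : ℝ → E →L[ℂ] E}
variable [TopologicalSpace.SeparableSpace E]

theorem traceNorm_average (hB : IsSandwichFamily μ B) {P : E →L[ℂ] E} (hP : 0 ≤ P) :
    traceNorm (hB.average P) = traceNorm P := by
  rw [traceNorm_of_nonneg hP, traceNorm_of_nonneg (hB.average_nonneg hP)]
  refine iSup_congr fun w => iSup_congr fun b => ?_
  have := HilbertBasis.countable_index b
  exact hB.diagNorm_average b hP

theorem tsum_diag_average (hB : IsSandwichFamily μ B) {w : Set E} (b : HilbertBasis w ℂ E)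
    {P : E →L[ℂ] E} (hP : 0 ≤ P) :
    ∑' i, ⟪b i, hB.average P (b i)⟫_ℂ = ∑' i, ⟪b i, P (b i)⟫_ℂ := by
  have := HilbertBasis.countable_index b
  -- No trace class hypothesis is needed: if the sum diverges, both sides take the default value
  -- `0`.
  have key : ∀ {Q : E →L[ℂ] E}, 0 ≤ Q →
      ∑' i, ⟪b i, Q (b i)⟫_ℂ = ((diagNorm b Q).toReal : ℂ) := by
    intro Q hQ
    rw [diagNorm, ENNReal.tsum_toReal_eq (fun i => enorm_ne_top), Complex.ofReal_tsum]
    refine tsum_congr fun i => ?_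
    rw [toReal_enorm, inner_apply_eq_norm_sqrt_sq hQ, Complex.norm_real,
      Real.norm_of_nonneg (by positivity)]
  rw [key hP, key (hB.average_nonneg hP), hB.diagNorm_average b hP]

theorem average_eq_posPart_sub (hB : IsSandwichFamily μ B) {A : E →L[ℂ] E} (hA : IsSelfAdjoint A) :
    hB.average A = hB.average A⁺ - hB.average A⁻ := by
  rw [← average_sub, CFC.posPart_sub_negPart A hA]

theorem isTraceClass_average (hB : IsSandwichFamily μ B) {A : E →L[ℂ] E} (hA : IsSelfAdjoint A)
    (ht : IsTraceClass A) : IsTraceClass (hB.average A) := by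
  obtain ⟨h1, h2⟩ := isTraceClass_posPart hA ht
  rw [hB.average_eq_posPart_sub hA, sub_eq_add_neg]
  refine ne_top_of_le_ne_top ?_ (traceNorm_add_le _ _)
  rw [traceNorm_neg, hB.traceNorm_average (CFC.posPart_nonneg A),
    hB.traceNorm_average (CFC.negPart_nonneg A)]
  exact ENNReal.add_ne_top.2 ⟨h1, h2⟩

theorem hasTrace_average (hB : IsSandwichFamily μ B) {A : E →L[ℂ] E} (hA : IsSelfAdjoint A)
    (ht : IsTraceClass A) {z : ℂ} (hz : HasTrace A z) : HasTrace (hB.average A) z := by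
  obtain ⟨h1, h2⟩ := isTraceClass_posPart hA ht
  have hp := CFC.posPart_nonneg A
  have hn := CFC.negPart_nonneg A
  have h1' : IsTraceClass (hB.average A⁺) := by rwa [IsTraceClass, hB.traceNorm_average hp]
  have h2' : IsTraceClass (hB.average A⁻) := by rwa [IsTraceClass, hB.traceNorm_average hn]
  intro w b
  have hs := (summable_diag b h1').hasSum.sub (summable_diag b h2').hasSum
  have hs' := (summable_diag b h1).hasSum.sub (summable_diag b h2).hasSum
  rw [hB.tsum_diag_average b hp, hB.tsum_diag_average b hn] at hs
  simp only [← inner_sub_right, ← sub_apply] at hs hs'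
  rw [← average_sub, CFC.posPart_sub_negPart A hA] at hs
  rw [CFC.posPart_sub_negPart A hA] at hs'
  rwa [hs'.unique (hz w b)] at hs

end IsSandwichFamily

end Sandwich

/-! ### The three families satisfy `∫ B(x)² dμ = 1` -/

section Families

open Filter Topology MeasureTheory

variable {E : Type*} [NormedAddCommGroup E] [InnerProductSpace ℂ E] [CompleteSpace E]

theorem denseRange_of_isSelfAdjoint {S : E →L[ℂ] E} (hS : IsSelfAdjoint S)
    (hk : ∀ f, S f = 0 → f = 0) : DenseRange S := by
  have h := S.orthogonal_range
  rw [hS.adjoint_eq, (LinearMap.ker_eq_bot' (f := (S : E →ₗ[ℂ] E))).2 hk] at h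
  have h2 := (Submodule.topologicalClosure_eq_top_iff (K := (S : E →ₗ[ℂ] E).range)).2 h
  exact (Submodule.dense_iff_topologicalClosure_eq_top).2 h2

theorem sqrt_apply_sqrt_apply {P : E →L[ℂ] E} (hP : 0 ≤ P) (f : E) :
    CFC.sqrt P (CFC.sqrt P f) = P f :=
  DFunLike.congr_fun (CFC.sqrt_mul_sqrt_self P hP) f

theorem sqrt_apply_eq_zero {P : E →L[ℂ] E} (hP : 0 ≤ P) (hk : ∀ f, P f = 0 → f = 0) (f : E)
    (hf : CFC.sqrt P f = 0) : f = 0 := by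
  refine hk f ?_
  rw [← sqrt_apply_sqrt_apply hP, hf, map_zero]

theorem commute_sqrt_self {P : E →L[ℂ] E} (hP : 0 ≤ P) : Commute (CFC.sqrt P) P := by
  have h : Commute (CFC.sqrt P) (CFC.sqrt P * CFC.sqrt P) :=
    (Commute.refl _).mul_right (Commute.refl _)
  rwa [CFC.sqrt_mul_sqrt_self P hP] at h

theorem tendsto_zero_of_denseRange {α : Type*} {l : Filter α} {L : α → E →L[ℂ] E} {S : E → E}
    (hS : DenseRange S) (hL : ∀ᶠ x in l, ∀ f, ‖L x f‖ ≤ ‖f‖)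
    (h : ∀ g, Tendsto (fun x => L x (S g)) l (𝓝 0)) (f : E) :
    Tendsto (fun x => L x f) l (𝓝 0) := by
  rw [Metric.tendsto_nhds]
  intro ε hε
  obtain ⟨g, hg⟩ := Metric.denseRange_iff.1 hS f (ε / 2) (half_pos hε)
  filter_upwards [hL, Metric.tendsto_nhds.1 (h g) (ε / 2) (half_pos hε)] with x h1 h2
  rw [dist_zero_right] at h2 ⊢
  have h3 : L x f = L x (f - S g) + L x (S g) := by rw [map_sub]; abel
  rw [h3]
  rw [dist_eq_norm] at hg
  have := norm_add_le (L x (f - S g)) (L x (S g))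
  have := h1 (f - S g)
  linarith

theorem lintegral_Ioi_of_hasDerivAt_sq {u : ℝ → E} {g : ℝ → ℝ} {l : ℝ}
    (hc : ContinuousWithinAt g (Set.Ici 0) 0)
    (hd : ∀ x ∈ Set.Ioi (0 : ℝ), HasDerivAt g (‖u x‖ ^ 2) x) (hl : Tendsto g atTop (𝓝 l)) :
    ∫⁻ x in Set.Ioi (0 : ℝ), ‖u x‖ₑ ^ 2 = ENNReal.ofReal (l - g 0) := by
  have hn : ∀ x ∈ Set.Ioi (0 : ℝ), 0 ≤ ‖u x‖ ^ 2 := fun x _ => by positivity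
  rw [← integral_Ioi_of_hasDerivAt_of_nonneg hc hd hn hl,
    ofReal_integral_eq_lintegral_ofReal (integrableOn_Ioi_deriv_of_nonneg hc hd hn hl)
      (ae_of_all _ fun x => by positivity)]
  simp_rw [← ofReal_norm, ← ENNReal.ofReal_pow (norm_nonneg _)]

theorem hasDerivAt_clm_apply_const {L : ℝ → E →L[ℂ] E} {L' : E →L[ℂ] E} {x : ℝ}
    (h : HasDerivAt L L' x) (f : E) : HasDerivAt (fun y => L y f) (L' f) x :=
  ((ContinuousLinearMap.apply ℂ E f).restrictScalars ℝ).hasFDerivAt.comp_hasDerivAt x h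

section Resolvent

variable {P : E →L[ℂ] E}

theorem hasDerivAt_resolvent (hP : 0 ≤ P) {x : ℝ} (hx : 0 < x) :
    HasDerivAt (resolvent P) (-(resolvent P x * resolvent P x)) x := by
  obtain ⟨u, hu⟩ := isUnit_shift hP hx
  have h1 : HasDerivAt (fun y : ℝ => P + (y : ℂ) • (1 : E →L[ℂ] E)) (1 : E →L[ℂ] E) x := by
    have h2 : HasDerivAt (fun y : ℝ => (y : ℂ) • (1 : E →L[ℂ] E)) ((1 : ℂ) • 1) x :=
      (Complex.ofRealCLM.hasDerivAt (x := x)).smul_const (1 : E →L[ℂ] E)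
    rw [one_smul] at h2
    exact h2.const_add P
  have h3 := hasFDerivAt_ringInverse (𝕜 := ℝ) u
  rw [hu] at h3
  have h4 := h3.comp_hasDerivAt x h1
  have h5 : resolvent P x = ↑u⁻¹ := by rw [resolvent, ← hu, Ring.inverse_unit]
  rw [h5]
  refine h4.congr_deriv ?_
  simp

/-- A primitive of `‖(P + x)⁻¹ P^{1/2} f‖²` is `x ⟨f, (P + x)⁻¹ f⟩`. It tends to `‖f‖²` at infinity
and, because `P` has trivial kernel, to `0` at the origin. -/
theorem isSandwichFamily_resolvent (hP : 0 ≤ P) (hk : ∀ f, P f = 0 → f = 0) :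
    IsSandwichFamily (volume.restrict (Set.Ioi (0 : ℝ)))
      (fun x => resolvent P x * CFC.sqrt P) where
  selfAdjoint x := by
    have hc := commute_resolvent (commute_sqrt_self hP) x
    rw [isSelfAdjoint_iff, star_mul, (isSelfAdjoint_resolvent hP.isSelfAdjoint x).star_eq,
      (CFC.sqrt_nonneg P).isSelfAdjoint.star_eq, hc.eq]
  aestronglyMeasurable f := by
    refine ContinuousOn.aestronglyMeasurable (fun x hx => ?_) measurableSet_Ioi
    exact (hasDerivAt_clm_apply_const (hasDerivAt_resolvent hP hx)
      (CFC.sqrt P f)).continuousAt.continuousWithinAt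
  lintegral_sq f := by
    have hR : ∀ x, IsSelfAdjoint (resolvent P x) := isSelfAdjoint_resolvent hP.isSelfAdjoint
    have hle : ∀ x : ℝ, 0 < x → ∀ g, ‖((x : ℂ) • resolvent P x) g‖ ≤ ‖g‖ := by
      intro x hx g
      rw [smul_apply, norm_smul, Complex.norm_real, Real.norm_of_nonneg hx.le]
      exact norm_smul_resolvent_apply_le hP hx g
    -- On the dense range of `P` one has `‖x (P + x)⁻¹ P g‖ ≤ x ‖g‖`; contractivity extends the
    -- limit to all vectors.
    have hzero : ∀ f, Tendsto (fun x : ℝ => ((x : ℂ) • resolvent P x) f) (𝓝[>] 0) (𝓝 0) := by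
      refine tendsto_zero_of_denseRange (denseRange_of_isSelfAdjoint hP.isSelfAdjoint hk)
        (eventually_nhdsWithin_of_forall hle) fun g => ?_
      have hlim : Tendsto (fun x : ℝ => x * ‖g‖) (𝓝[>] 0) (𝓝 0) := by
        have : Continuous fun x : ℝ => x * ‖g‖ := by fun_prop
        simpa using (this.tendsto 0).mono_left nhdsWithin_le_nhds
      refine squeeze_zero_norm' (eventually_nhdsWithin_of_forall fun x hx => ?_) hlim
      rw [smul_apply, norm_smul, Complex.norm_real, Real.norm_of_nonneg (le_of_lt hx)]
      refine mul_le_mul_of_nonneg_left ?_ (le_of_lt hx)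
      have h1 : resolvent P x (P g) = P (resolvent P x g) :=
        (DFunLike.congr_fun (commute_resolvent (Commute.refl P) x).eq g).symm
      rw [h1]
      exact norm_mul_resolvent_apply_le hP hx g
    have hg : ∀ x : ℝ, x * RCLike.re ⟪f, resolvent P x f⟫_ℂ =
        RCLike.re ⟪f, ((x : ℂ) • resolvent P x) f⟫_ℂ := by
      intro x
      rw [smul_apply, inner_smul_right, RCLike.re_eq_complex_re, Complex.re_ofReal_mul]
    have hmain := lintegral_Ioi_of_hasDerivAt_sq (u := fun x => (resolvent P x * CFC.sqrt P) f)
      (g := fun x => x * RCLike.re ⟪f, resolvent P x f⟫_ℂ) (l := ‖f‖ ^ 2) ?_ ?_ ?_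
    · rw [hmain]
      rw [zero_mul, sub_zero, ENNReal.ofReal_pow (norm_nonneg _), ofReal_norm]
    -- The value of the primitive at `0` is `0` whatever `resolvent P 0` is, thanks to the factor
    -- `x`.
    · rw [← continuousWithinAt_Ioi_iff_Ici, ContinuousWithinAt, zero_mul]
      simp_rw [hg]
      have hi : Continuous fun v : E => RCLike.re ⟪f, v⟫_ℂ := by fun_prop
      have := (hi.tendsto 0).comp (hzero f)
      rwa [inner_zero_right, map_zero] at this
    · intro x hx
      have h1 := hasDerivAt_clm_apply_const (hasDerivAt_resolvent hP hx) f
      have h2 := (Complex.reCLM.hasFDerivAt.comp_hasDerivAt x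
        ((hasDerivAt_const x f).inner ℂ h1))
      have h3 := (hasDerivAt_id x).mul h2
      refine h3.congr_deriv ?_
      have e1 : resolvent P x (CFC.sqrt P f) = CFC.sqrt P (resolvent P x f) :=
        (DFunLike.congr_fun (commute_resolvent (commute_sqrt_self hP) x).eq f).symm
      have e2 : ⟪f, resolvent P x f⟫_ℂ =
          ((‖CFC.sqrt P (resolvent P x f)‖ ^ 2 + x * ‖resolvent P x f‖ ^ 2 : ℝ) : ℂ) := by
        rw [← (hR x).isSymmetric.apply_clm]
        have e4 := shift_resolvent_apply hP hx f
        rw [shift_apply] at e4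
        have e5 := congrArg (fun v => ⟪resolvent P x f, v⟫_ℂ) e4
        rw [← e5]
        change ⟪resolvent P x f, P (resolvent P x f) + (x : ℂ) • resolvent P x f⟫_ℂ = _
        rw [inner_add_right, inner_smul_right, inner_apply_eq_norm_sqrt_sq hP,
          inner_self_eq_norm_sq_to_K]
        push_cast
        rfl
      have e3 : ⟪f, (-(resolvent P x * resolvent P x)) f⟫_ℂ =
          ((-‖resolvent P x f‖ ^ 2 : ℝ) : ℂ) := by
        rw [neg_apply, mul_apply_eq_comp, inner_neg_right, ← (hR x).isSymmetric.apply_clm,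
          inner_self_eq_norm_sq_to_K]
        push_cast
        rfl
      simp only [Function.comp, inner_zero_left, add_zero, id, one_mul, e2, e3, mul_apply_eq_comp,
        e1, Complex.reCLM_apply, Complex.ofReal_re]
      ring
    · simp_rw [hg]
      -- `x (P + x)⁻¹ f = f - P (P + x)⁻¹ f`, and the last term is at most `‖P‖ ‖f‖ / x`.
      have hRlim : Tendsto (fun x => P (resolvent P x f)) atTop (𝓝 0) := by
        have h1 : Tendsto (fun x : ℝ => ‖P‖ * (‖f‖ * x⁻¹)) atTop (𝓝 0) := by
          simpa using (tendsto_inv_atTop_zero.const_mul ‖f‖).const_mul ‖P‖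
        refine squeeze_zero_norm' ?_ h1
        filter_upwards [eventually_gt_atTop 0] with x hx
        refine (P.le_opNorm _).trans (mul_le_mul_of_nonneg_left ?_ (norm_nonneg _))
        rw [← div_eq_mul_inv, le_div_iff₀ hx, mul_comm]
        exact norm_smul_resolvent_apply_le hP hx f
      have hlim : Tendsto (fun x : ℝ => ((x : ℂ) • resolvent P x) f) atTop (𝓝 f) := by
        have h2 := (tendsto_const_nhds (x := f)).sub hRlim
        rw [sub_zero] at h2
        refine h2.congr' ?_
        filter_upwards [eventually_gt_atTop 0] with x hx
        have := shift_resolvent_apply hP hx f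
        rw [shift_apply] at this
        exact (eq_sub_of_add_eq' this).symm
      have hi : Continuous fun v : E => RCLike.re ⟪f, v⟫_ℂ := by fun_prop
      have := (hi.tendsto f).comp hlim
      rwa [inner_self_eq_norm_sq] at this

end Resolvent

section Semigroup

variable {P : E →L[ℂ] E}

theorem hasDerivAt_semigroup (P : E →L[ℂ] E) (s : ℝ) :
    HasDerivAt (semigroup P) (((-1 / 2 : ℝ) : ℂ) • (semigroup P s * P)) s := by
  have h1 : HasDerivAt (fun t : ℝ => ((-t / 2 : ℝ) : ℂ)) ((-1 / 2 : ℝ) : ℂ) s :=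
    ((hasDerivAt_id s).neg.div_const 2).ofReal_comp
  exact (hasDerivAt_exp_smul_const P (((-s / 2 : ℝ) : ℂ))).scomp s h1

theorem commute_semigroup {Q : E →L[ℂ] E} (h : Commute Q P) (s : ℝ) : Commute Q (semigroup P s) :=
  (Commute.smul_right h _).exp_right

theorem isSelfAdjoint_semigroup (hP : IsSelfAdjoint P) (s : ℝ) : IsSelfAdjoint (semigroup P s) := by
  have : IsSelfAdjoint ((((-s / 2 : ℝ)) : ℂ) • P) :=
    IsSelfAdjoint.smul (Complex.conj_ofReal _) hP
  exact this.exp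

theorem hasDerivAt_norm_semigroup_sq (hP : 0 ≤ P) (f : E) (s : ℝ) :
    HasDerivAt (fun s => -‖semigroup P s f‖ ^ 2) (‖CFC.sqrt P (semigroup P s f)‖ ^ 2) s := by
  have h1 := hasDerivAt_clm_apply_const (hasDerivAt_semigroup P s) f
  have h2 := (Complex.reCLM.hasFDerivAt.comp_hasDerivAt s (h1.inner ℂ h1)).neg
  have h3 : (fun s => -‖semigroup P s f‖ ^ 2) =
      -(Complex.reCLM ∘ fun s => ⟪semigroup P s f, semigroup P s f⟫_ℂ) := by
    ext t
    simp only [Pi.neg_apply, Function.comp, inner_self_eq_norm_sq_to_K]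
    rw [← RCLike.ofReal_pow]
    exact congrArg Neg.neg (Complex.ofReal_re _).symm
  rw [h3]
  refine h2.congr_deriv ?_
  have e1 : (semigroup P s * P) f = P (semigroup P s f) :=
    (DFunLike.congr_fun (commute_semigroup (Commute.refl P) s).eq f).symm
  rw [smul_apply, e1, inner_smul_left, inner_smul_right, hP.isSelfAdjoint.isSymmetric.apply_clm,
    inner_apply_eq_norm_sqrt_sq hP, Complex.conj_ofReal, ← Complex.ofReal_mul, ← Complex.ofReal_add]
  rw [Complex.reCLM_apply, Complex.ofReal_re]
  ring

theorem norm_semigroup_apply_antitone (hP : 0 ≤ P) (f : E) :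
    Antitone fun s => ‖semigroup P s f‖ := by
  have h : Monotone fun s => -‖semigroup P s f‖ ^ 2 :=
    monotone_of_hasDerivAt_nonneg (hasDerivAt_norm_semigroup_sq hP f) fun s => by positivity
  intro s t hst
  exact le_of_sq_le_sq (neg_le_neg_iff.1 (h hst)) (norm_nonneg _)

theorem semigroup_zero (P : E →L[ℂ] E) : semigroup P 0 = 1 := by
  simp [semigroup]

/-- By density it suffices to treat `f = P^{1/2} h`. Then `‖e^{-sP/2} f‖²` is decreasing and is the
derivative of `-‖e^{-sP/2} h‖²`, whose total increase is at most `‖h‖²`; hence it is at most `‖h‖² /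
s`. -/
theorem tendsto_semigroup_atTop (hP : 0 ≤ P) (hk : ∀ f, P f = 0 → f = 0) (f : E) :
    Tendsto (fun s => semigroup P s f) atTop (𝓝 0) := by
  refine tendsto_zero_of_denseRange (denseRange_of_isSelfAdjoint
    (CFC.sqrt_nonneg P).isSelfAdjoint (sqrt_apply_eq_zero hP hk)) ?_ (fun h => ?_) f
  · filter_upwards [eventually_ge_atTop 0] with s hs g
    have := norm_semigroup_apply_antitone hP g hs
    simpa [semigroup_zero] using this
  · have hcomm : ∀ s, semigroup P s (CFC.sqrt P h) = CFC.sqrt P (semigroup P s h) := fun s =>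
      (DFunLike.congr_fun (commute_semigroup (commute_sqrt_self hP) s).eq h).symm
    have hbound : ∀ s > 0, ‖semigroup P s (CFC.sqrt P h)‖ ^ 2 ≤ ‖h‖ ^ 2 * s⁻¹ := by
      intro s hs
      have hd := hasDerivAt_norm_semigroup_sq hP h
      have := Convex.mul_sub_le_image_sub_of_le_deriv (convex_Icc 0 s)
        (f := fun s => -‖semigroup P s h‖ ^ 2)
        (fun x _ => (hd x).continuousAt.continuousWithinAt)
        (fun x _ => (hd x).differentiableAt.differentiableWithinAt)
        (C := ‖semigroup P s (CFC.sqrt P h)‖ ^ 2) (fun x hx => by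
          rw [(hd x).deriv, ← hcomm]
          rw [interior_Icc] at hx
          have := norm_semigroup_apply_antitone hP (CFC.sqrt P h) hx.2.le
          gcongr) 0 (by simp [hs.le]) s (by simp [hs.le]) hs.le
      rw [semigroup_zero, one_apply_eq_self, sub_zero] at this
      rw [← div_eq_mul_inv, le_div_iff₀ hs]
      nlinarith [sq_nonneg ‖semigroup P s h‖]
    have hsq : Tendsto (fun s => ‖semigroup P s (CFC.sqrt P h)‖ ^ 2) atTop (𝓝 0) := by
      have h1 : Tendsto (fun s : ℝ => ‖h‖ ^ 2 * s⁻¹) atTop (𝓝 0) := by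
        simpa using tendsto_inv_atTop_zero.const_mul (‖h‖ ^ 2)
      refine squeeze_zero' (Eventually.of_forall fun s => by positivity) ?_ h1
      filter_upwards [eventually_gt_atTop 0] with s hs using hbound s hs
    rw [tendsto_zero_iff_norm_tendsto_zero]
    have := hsq.sqrt
    simpa [Real.sqrt_sq] using this

/-- The primitive is `-‖e^{-sP/2} f‖²`, which rises from `-‖f‖²` to `0`; the factor `1/2` in the
exponent makes the normalization exact. -/
theorem isSandwichFamily_semigroup (hP : 0 ≤ P) (hk : ∀ f, P f = 0 → f = 0) :
    IsSandwichFamily (volume.restrict (Set.Ioi (0 : ℝ)))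
      (fun s => semigroup P s * CFC.sqrt P) where
  selfAdjoint s := by
    have hc := commute_semigroup (commute_sqrt_self hP) s
    rw [isSelfAdjoint_iff, star_mul, (isSelfAdjoint_semigroup hP.isSelfAdjoint s).star_eq,
      (CFC.sqrt_nonneg P).isSelfAdjoint.star_eq, hc.eq]
  aestronglyMeasurable f := by
    refine ContinuousOn.aestronglyMeasurable (fun s hs => ?_) measurableSet_Ioi
    exact (hasDerivAt_clm_apply_const (hasDerivAt_semigroup P s)
      (CFC.sqrt P f)).continuousAt.continuousWithinAt
  lintegral_sq f := by
    have hd := hasDerivAt_norm_semigroup_sq hP f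
    have hmain := lintegral_Ioi_of_hasDerivAt_sq
      (u := fun s => (semigroup P s * CFC.sqrt P) f) (l := 0)
      (hd 0).continuousAt.continuousWithinAt (fun s _ => ?_) ?_
    · rw [hmain, semigroup_zero, one_apply_eq_self, zero_sub, neg_neg,
        ENNReal.ofReal_pow (norm_nonneg _), ofReal_norm]
    · have hc := DFunLike.congr_fun (commute_semigroup (commute_sqrt_self hP) s).eq f
      refine (hd s).congr_deriv ?_
      rw [← hc]
      rfl
    · have := ((tendsto_semigroup_atTop hP hk f).norm.pow 2).neg
      simpa using this

end Semigroup

theorem isSandwichFamily_one :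
    IsSandwichFamily (Measure.dirac (0 : ℝ)) (fun _ => (1 : E →L[ℂ] E)) where
  selfAdjoint _ := IsSelfAdjoint.one _
  aestronglyMeasurable f := aestronglyMeasurable_const
  lintegral_sq f := by simp

end Families

/-! ### From bounded operators to the operator of the form -/

section SelfAdjointOperator

open MeasureTheory

variable {E : Type*} [NormedAddCommGroup E] [InnerProductSpace ℂ E] [CompleteSpace E]

theorem mem_graph_inverse_toPMap {S : E →L[ℂ] E} (hinj : ∀ f, S f = 0 → f = 0) (v w : E) :
    (v, w) ∈ ((S : E →ₗ[ℂ] E).toPMap ⊤).inverse.graph ↔ S w = v := by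
  rw [LinearPMap.inverse_graph]
  · simp [LinearPMap.mem_graph_iff]
  · rw [LinearMap.ker_eq_bot']
    intro f hf
    exact Subtype.ext (hinj f hf)

/-- The domain `Ran S` is dense. If `z = K* y`, then `⟨w, S z⟩ = ⟨S w, z⟩ = ⟨w, y⟩` for all `w`, so
`S z = y` and `(y, z)` lies in the graph of `K`. -/
theorem isSelfAdjoint_inverse_toPMap {S : E →L[ℂ] E} (hS : IsSelfAdjoint S)
    (hinj : ∀ f, S f = 0 → f = 0) :
    IsSelfAdjoint ((S : E →ₗ[ℂ] E).toPMap ⊤).inverse := by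
  set K := ((S : E →ₗ[ℂ] E).toPMap ⊤).inverse with hK
  have hgraph : ∀ v w, (v, w) ∈ K.graph ↔ S w = v := mem_graph_inverse_toPMap hinj
  have hmem : ∀ w, S w ∈ K.domain := fun w => LinearPMap.mem_domain_of_mem_graph ((hgraph _ _).2 rfl)
  have hval : ∀ x : K.domain, S (K x) = x := fun x => (hgraph _ _).1 (K.mem_graph x)
  have hK' : ∀ w, K ⟨S w, hmem w⟩ = w := fun w => by
    refine sub_eq_zero.1 (hinj _ ?_)
    rw [map_sub, hval, sub_self]
  have hdense : Dense (K.domain : Set E) :=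
    (denseRange_of_isSelfAdjoint hS hinj).mono (by rintro _ ⟨w, rfl⟩; exact hmem w)
  rw [LinearPMap.isSelfAdjoint_def]
  refine le_antisymm (LinearPMap.le_of_le_graph ?_) (LinearPMap.IsFormalAdjoint.le_adjoint hdense ?_)
  · rintro ⟨y, z⟩ hyz
    rw [LinearPMap.mem_graph_iff] at hyz
    obtain ⟨y', rfl, rfl⟩ := hyz
    rw [hgraph]
    refine ext_inner_left ℂ fun w => ?_
    have h := LinearPMap.adjoint_isFormalAdjoint hdense y' ⟨S w, hmem w⟩
    rw [hK'] at h
    change ⟪_, S w⟫_ℂ = _ at h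
    rw [← hS.isSymmetric.apply_clm, ← inner_conj_symm, h, inner_conj_symm]
  · intro x y
    conv_lhs => rw [← hval y, ← hS.isSymmetric.apply_clm, hval]

theorem ker_toPMap_sqrt {P : E →L[ℂ] E} (hP : 0 ≤ P) (hk : ∀ f, P f = 0 → f = 0) :
    (((CFC.sqrt P : E →L[ℂ] E) : E →ₗ[ℂ] E).toPMap ⊤).toFun.ker = ⊥ := by
  rw [LinearMap.ker_eq_bot']
  intro f hf
  exact Subtype.ext (sqrt_apply_eq_zero hP hk f hf)

theorem invSqrt_sqrtVec {P : E →L[ℂ] E} (hP : 0 ≤ P) (hk : ∀ f, P f = 0 → f = 0) (f : E) :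
    invSqrt P (sqrtVec P f) = f :=
  LinearPMap.inverse_apply_eq (ker_toPMap_sqrt hP hk) (x := ⟨f, trivial⟩) rfl

theorem exists_eq_sqrtVec (P : E →L[ℂ] E) (u : (invSqrt P).domain) : ∃ f, u = sqrtVec P f := by
  obtain ⟨u, hu⟩ := u
  have h := hu
  rw [invSqrt, LinearPMap.inverse_domain] at h
  obtain ⟨f, rfl⟩ := h
  exact ⟨f, rfl⟩

/-- Each of the forms is, after the substitution `u = ρ^{1/2} f`, `v = ρ^{1/2} g`, the form of an
average of `A`. -/
theorem exists_isSandwichFamily (m : Model) {P : E →L[ℂ] E} (hP : 0 ≤ P)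
    (hk : ∀ f, P f = 0 → f = 0) :
    ∃ (μ : Measure ℝ) (B : ℝ → E →L[ℂ] E) (hB : IsSandwichFamily μ B), ∀ (A : E →L[ℂ] E) (f g : E),
      ldForm m P A (sqrtVec P f) (sqrtVec P g) = ⟪f, hB.average A g⟫_ℂ ∧
      LDFormConverges m P A (sqrtVec P f) (sqrtVec P g) := by
  cases m with
  | boltzmannVonNeumann =>
    have hB := isSandwichFamily_resolvent hP hk
    exact ⟨_, _, hB, fun A f g => ⟨(hB.inner_average A f g).symm, hB.integrable_inner A f g⟩⟩
  | sandwich =>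
    have hB : IsSandwichFamily (E := E) _ _ := isSandwichFamily_one
    refine ⟨_, _, hB, fun A f g => ⟨?_, trivial⟩⟩
    rw [hB.inner_average A f g, integral_dirac]
    simp only [ldForm, invSqrt_sqrtVec hP hk, one_apply_eq_self]
  | symmetric =>
    have hB := isSandwichFamily_semigroup hP hk
    exact ⟨_, _, hB, fun A f g => ⟨(hB.inner_average A f g).symm, hB.integrable_inner A f g⟩⟩

/-- The associated operator is `P^{-1/2} G P^{-1/2}`, written without inverses: move `P^{1/2}`
across the inner product and test against all `f`. -/
theorem inFormGraph_iff {P : E →L[ℂ] E} {q : (invSqrt P).domain → (invSqrt P).domain → ℂ}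
    {G : E →L[ℂ] E} (hq : ∀ f g, q (sqrtVec P f) (sqrtVec P g) = ⟪f, G g⟫_ℂ) (v w : E) :
    InFormGraph (invSqrt P).domain q v w ↔ ∃ g, CFC.sqrt P g = v ∧ CFC.sqrt P w = G g := by
  have hS : IsSelfAdjoint (CFC.sqrt P) := (CFC.sqrt_nonneg P).isSelfAdjoint
  constructor
  · rintro ⟨hv, h⟩
    obtain ⟨g, hg⟩ := exists_eq_sqrtVec P ⟨v, hv⟩
    refine ⟨g, (congrArg Subtype.val hg).symm, ext_inner_left ℂ fun f => ?_⟩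
    rw [← hq, ← hg, h, ← hS.isSymmetric.apply_clm]
    rfl
  · rintro ⟨g, rfl, h⟩
    refine ⟨sqrt_mem_domain P g, fun u => ?_⟩
    obtain ⟨f, rfl⟩ := exists_eq_sqrtVec P u
    change q (sqrtVec P f) (sqrtVec P g) = ⟪CFC.sqrt P f, w⟫_ℂ
    rw [hq, ← h, hS.isSymmetric.apply_clm]

theorem isUnit_add_norm_add_one {A : E →L[ℂ] E} {N : ℝ}
    (hA : ∀ f, -(N * ‖f‖ ^ 2) ≤ RCLike.re ⟪f, A f⟫_ℂ) :
    IsUnit (A + ((N + 1 : ℝ) : ℂ) • 1) := by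
  refine ContinuousLinearMap.isUnit_of_forall_le_norm_inner_map _ (c := 1) one_pos fun f => ?_
  rw [norm_inner_symm]
  refine le_trans ?_ (Complex.re_le_norm _)
  have h : ⟪f, (A + ((N + 1 : ℝ) : ℂ) • 1) f⟫_ℂ = ⟪f, A f⟫_ℂ + (((N + 1) * ‖f‖ ^ 2 : ℝ) : ℂ) := by
    rw [shift_apply, inner_add_right, inner_smul_right, inner_self_eq_norm_sq_to_K]
    push_cast
    rfl
  rw [h, Complex.add_re, Complex.ofReal_re]
  have h2 : -(N * ‖f‖ ^ 2) ≤ (⟪f, A f⟫_ℂ).re := hA f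
  simp only [NNReal.coe_one, mul_one]
  linarith

theorem IsSandwichFamily.neg_norm_mul_sq_le_re_inner_average {μ : Measure ℝ} {B : ℝ → E →L[ℂ] E}
    (hB : IsSandwichFamily μ B) (A : E →L[ℂ] E) (f : E) :
    -(‖A‖ * ‖f‖ ^ 2) ≤ RCLike.re ⟪f, hB.average A f⟫_ℂ := by
  have h := norm_inner_le_norm (𝕜 := ℂ) (hB.embed f) (A.compLpL 2 μ (hB.embed f))
  rw [← inner_average_aux, hB.embed.norm_map] at h
  have h2 := A.norm_compLp_le (hB.embed f)
  rw [hB.embed.norm_map] at h2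
  have h3 : ‖A.compLpL 2 μ (hB.embed f)‖ ≤ ‖A‖ * ‖f‖ := h2
  have h4 := abs_le.1 ((RCLike.abs_re_le_norm (⟪f, hB.average A f⟫_ℂ)).trans h)
  nlinarith [mul_le_mul_of_nonneg_left h3 (norm_nonneg f), h4.1]

end SelfAdjointOperator

end QuantumLD

open QuantumLD

theorem theorem5p2 {E : Type*} [NormedAddCommGroup E] [InnerProductSpace ℂ E] [CompleteSpace E]
    [TopologicalSpace.SeparableSpace E]
    (I : Set ℝ) (hI_open : IsOpen I) (hI_interval : I.OrdConnected)
    (ρ : ℝ → E →L[ℂ] E)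
    (h_state : ∀ θ ∈ I, QuantumLD.IsState (ρ θ))
    (h_ker : ∀ θ ∈ I, ∀ f : E, ρ θ f = 0 → f = 0)
    (h_analytic : QuantumLD.IsTraceNormAnalyticOn ρ I)
    (θ : ℝ) (hθ : θ ∈ I) (m : QuantumLD.Model) :
    -- the forms of the logarithmic derivative and of its shifted version make sense
    (∀ u v : (QuantumLD.invSqrt (ρ θ)).domain,
      QuantumLD.LDFormConverges m (ρ θ) (deriv ρ θ) u v ∧
      QuantumLD.LDFormConverges m (ρ θ) (QuantumLD.shifted (deriv ρ θ)) u v) ∧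
    -- the shifted form is that of a self-adjoint operator `K`
    ∃ K : E →ₗ.[ℂ] E, IsSelfAdjoint K ∧
      (∀ v w : E, (v, w) ∈ K.graph ↔
        QuantumLD.InFormGraph (QuantumLD.invSqrt (ρ θ)).domain
          (QuantumLD.ldForm m (ρ θ) (QuantumLD.shifted (deriv ρ θ))) v w) ∧
    -- the sandwiched logarithmic derivative is a bounded operator `T`
    ∃ T : E →L[ℂ] E,
      (∀ f g : E, inner ℂ f (T g) =
        QuantumLD.ldForm m (ρ θ) (deriv ρ θ)
          (QuantumLD.sqrtVec (ρ θ) f) (QuantumLD.sqrtVec (ρ θ) g)) ∧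
      (∀ f w : E,
        QuantumLD.InFormGraph (QuantumLD.invSqrt (ρ θ)).domain
          (QuantumLD.ldForm m (ρ θ) (deriv ρ θ)) (CFC.sqrt (ρ θ) f) w →
        CFC.sqrt (ρ θ) w = T f) ∧
      Dense {f : E | CFC.sqrt (ρ θ) f ∈ K.domain} ∧
      (∀ (f : E) (hf : CFC.sqrt (ρ θ) f ∈ K.domain),
        CFC.sqrt (ρ θ) (K ⟨CFC.sqrt (ρ θ) f, hf⟩) =
          T f + (((‖deriv ρ θ‖ + 1 : ℝ)) : ℂ) • f) ∧
      -- it is trace class, with trace zero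
      QuantumLD.IsTraceClass T ∧ QuantumLD.HasTrace T 0 := by
  obtain ⟨A, hA, hAt, hA0⟩ := exists_hasDerivAt_trace_zero hI_open h_state h_analytic hθ
  have hpos : ∀ t ∈ I, 0 ≤ ρ t := fun t ht =>
    (ContinuousLinearMap.nonneg_iff_isPositive _).2 (h_state t ht).pos
  have hAs := isSelfAdjoint_of_hasDerivAt hI_open (fun t ht => (hpos t ht).isSelfAdjoint) hθ hA
  rw [hA.deriv]
  have hP := hpos θ hθ
  have hk := h_ker θ hθ
  generalize ρ θ = P at hP hk
  obtain ⟨μ, B, hB, hform⟩ := exists_isSandwichFamily m hP hk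
  set S := CFC.sqrt P with hSdef
  have hS : IsSelfAdjoint S := (CFC.sqrt_nonneg P).isSelfAdjoint
  have hSinj : ∀ f, S f = 0 → f = 0 := sqrt_apply_eq_zero hP hk
  set T := hB.average A with hT
  set G := T + ((‖A‖ + 1 : ℝ) : ℂ) • (1 : E →L[ℂ] E) with hG
  have hGavg : hB.average (shifted A) = G := hB.average_add_smul_one A _
  have hGs : IsSelfAdjoint G :=
    (hB.isSelfAdjoint_average hAs).add (IsSelfAdjoint.smul (Complex.conj_ofReal _) (IsSelfAdjoint.one _))
  have hGu : IsUnit G := isUnit_add_norm_add_one (hB.neg_norm_mul_sq_le_re_inner_average A)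
  set R := Ring.inverse G with hR
  have hRs : IsSelfAdjoint R := by
    rw [isSelfAdjoint_iff, hR, ← Ring.inverse_star, hGs.star_eq]
  have hGR : ∀ f, G (R f) = f := DFunLike.congr_fun (Ring.mul_inverse_cancel _ hGu)
  have hRG : ∀ f, R (G f) = f := DFunLike.congr_fun (Ring.inverse_mul_cancel _ hGu)
  have hRinj : ∀ f, R f = 0 → f = 0 := fun f hf => by rw [← hGR f, hf, map_zero]
  -- The candidate for `K⁻¹`, as `K` should be `S⁻¹ G S⁻¹`.
  set L := S * R * S with hL
  have hLs : IsSelfAdjoint L := by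
    rw [isSelfAdjoint_iff, hL, star_mul, star_mul, hS.star_eq, hRs.star_eq, mul_assoc]
  have hLinj : ∀ f, L f = 0 → f = 0 := fun f hf => hSinj _ (hRinj _ (hSinj _ hf))
  have hgraph := mem_graph_inverse_toPMap hLinj
  have hKsa := isSelfAdjoint_inverse_toPMap hLs hLinj
  set K := ((L : E →ₗ[ℂ] E).toPMap ⊤).inverse with hK
  have hSL : ∀ f w, L w = S f ↔ S w = G f := by
    intro f w
    constructor
    · intro h
      have h1 : R (S w) = f := by
        refine sub_eq_zero.1 (hSinj _ ?_)
        rw [map_sub, sub_eq_zero]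
        exact h
      rw [← h1, hGR]
    · intro h
      change S (R (S w)) = S f
      rw [h, hRG]
  refine ⟨fun u v => ?_, K, hKsa, fun v w => ?_, T, fun f g => ((hform A f g).1).symm, ?_, ?_, ?_,
    hB.isTraceClass_average hAs hAt, hB.hasTrace_average hAs hAt hA0⟩
  · obtain ⟨f, rfl⟩ := exists_eq_sqrtVec P u
    obtain ⟨g, rfl⟩ := exists_eq_sqrtVec P v
    exact ⟨(hform _ f g).2, (hform _ f g).2⟩
  · rw [hgraph, inFormGraph_iff (P := P) (G := G) fun f g => by rw [(hform _ f g).1, hGavg]]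
    constructor
    · intro h
      exact ⟨R (S w), h, (hGR _).symm⟩
    · rintro ⟨g, rfl, h⟩
      exact (hSL g w).2 h
  · intro f w h
    obtain ⟨g, hg, h⟩ := (inFormGraph_iff (P := P) (G := T) (fun f g => (hform A f g).1) _ _).1 h
    have : g = f := by
      refine sub_eq_zero.1 (hSinj _ ?_)
      rw [map_sub, sub_eq_zero]
      exact hg
    rw [← this]
    exact h
  -- The domain of `K` is `Ran (S R S)`, so every vector `R S w` belongs to the set in question.
  · have hd : DenseRange (R * S) :=
      (denseRange_of_isSelfAdjoint hRs hRinj).comp (denseRange_of_isSelfAdjoint hS hSinj)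
        R.continuous
    refine hd.mono ?_
    rintro _ ⟨w, rfl⟩
    exact LinearPMap.mem_domain_of_mem_graph ((hgraph _ w).2 rfl)
  · intro f hf
    have h := (hgraph _ _).1 (K.mem_graph ⟨S f, hf⟩)
    rw [(hSL f _).1 h, hG, shift_apply]
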